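/- Let $G$ be a group with a generating family $S=(a,b)$ of two elements. For $n\ge 0$ let $r_n$ be the number of words of length $n$ in the four letters $a,a^{-1},b,b^{-1}$ that represent the identity of $G$ (the letters being regarded as distinct formal symbols), and let $p_n$ be the number of those among them that are freely reduced, i.e. contain no subword $aa^{-1}$, $a^{-1}a$, $bb^{-1}$ or $b^{-1}b$. Put $$\rho(G,S)=\limsup_{n\to\infty} r_n^{1/n},\qquad \alpha(G,S)=\limsup_{n\to\infty} p_n^{1/n}.$$ Consider the Baumslag--Solitar groups $BS(p,q)=\langle a,b\mid b a^p b^{-1}=a^q\rangle$ and Thompson's group $$F=\langle a,b\mid [ab^{-1},a^{-1}ba],\ [ab^{-1},a^{-2}ba^{2}]\rangle ,\qquad [x,y]=xyx^{-1}y^{-1},$$ each with its two standard generators $a,b$. Then $$\alpha(BS(2,2))\ge 2.5904,\quad \alpha(BS(2,3))\ge 2.42579,\quad \alpha(BS(3,5))\ge 2.06357,\quad \alpha(F)\ge 2.17329,$$ and $$\rho(BS(2,2))\ge 3.78522,\quad \rho(BS(2,3))\ge 3.66250,\quad \rho(BS(3,5))\ge 3.51736,\quad \rho(F)\ge 3.55368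 .$$ -/

import Mathlib

noncomputable section

open scoped commutatorElement

namespace Cogrowth

/-- The value in `G` of a word over the letters `s i` and `(s i)⁻¹`: the letter `(i, true)`
stands for `s i` and the letter `(i, false)` for its formal inverse. -/
def wordValue {G ι : Type} [Group G] (s : ι → G) (w : List (ι × Bool)) : G :=
  (w.map fun x => if x.2 then s x.1 else (s x.1)⁻¹).prod

/-- The words of length `n` that represent the identity; they are the paths of length `n` in the
labelled Cayley graph that start and end at the identity. -/
def returns {G ι : Type} [Group G] (s : ι → G) (n : ℕ) : Set (List (ι × Bool)) :=
  {w | w.length = n ∧ wordValue s w = 1}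

/-- The freely reduced words of length `n` that represent the identity (closed paths without
immediate reversals). -/
def reducedReturns {G ι : Type} [Group G] (s : ι → G) (n : ℕ) : Set (List (ι × Bool)) :=
  {w | w ∈ returns s n ∧ FreeGroup.IsReduced w}

/-- `r_n` -/
def numReturns {G ι : Type} [Group G] (s : ι → G) (n : ℕ) : ℕ :=
  (returns s n).ncard

/-- `p_n` -/
def numReducedReturns {G ι : Type} [Group G] (s : ι → G) (n : ℕ) : ℕ :=
  (reducedReturns s n).ncard

/-- `ρ = limsup r_n ^ (1/n)`, the growth rate of all trivial words. For finite `ι` the sequence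
lies between `0` and `2 * card ι` (see `numReturns_le`), so the real limsup is a genuine one. -/
def rho {G ι : Type} [Group G] (s : ι → G) : ℝ :=
  Filter.limsup (fun n : ℕ => (numReturns s n : ℝ) ^ (1 / (n : ℝ))) Filter.atTop

/-- `α = limsup p_n ^ (1/n)`, the growth rate of the freely reduced trivial words. -/
def alpha {G ι : Type} [Group G] (s : ι → G) : ℝ :=
  Filter.limsup (fun n : ℕ => (numReducedReturns s n : ℝ) ^ (1 / (n : ℝ))) Filter.atTop

theorem returns_finite {G ι : Type} [Group G] [Finite ι] (s : ι → G) (n : ℕ) :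
    (returns s n).Finite :=
  (List.finite_length_eq (ι × Bool) n).subset fun _ h => h.1

theorem numReturns_le {G ι : Type} [Group G] [Fintype ι] (s : ι → G) (n : ℕ) :
    numReturns s n ≤ (2 * Fintype.card ι) ^ n := by
  have h : (returns s n).ncard ≤ {w : List (ι × Bool) | w.length = n}.ncard :=
    Set.ncard_le_ncard (fun _ h => h.1) (List.finite_length_eq (ι × Bool) n)
  refine h.trans (le_of_eq ?_)
  have e : {w : List (ι × Bool) | w.length = n}.ncard = Nat.card (List.Vector (ι × Bool) n) := rfl
  rw [e, Nat.card_eq_fintype_card, card_vector, Fintype.card_prod, Fintype.card_bool, mul_comm]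

theorem numReducedReturns_le {G ι : Type} [Group G] [Finite ι] (s : ι → G) (n : ℕ) :
    numReducedReturns s n ≤ numReturns s n :=
  Set.ncard_le_ncard (fun _ h => h.1) (returns_finite s n)

/-- The free generator `a` of the free group on two letters. -/
def fa : FreeGroup (Fin 2) := FreeGroup.of 0

/-- The free generator `b` of the free group on two letters. -/
def fb : FreeGroup (Fin 2) := FreeGroup.of 1

/-- Baumslag–Solitar group `BS(p,q) = ⟨a, b ∣ b a^p b⁻¹ = a^q⟩`. -/
abbrev BS (p q : ℕ) : Type :=
  PresentedGroup ({fb * fa ^ p * fb⁻¹ * (fa ^ q)⁻¹} : Set (FreeGroup (Fin 2)))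

/-- The generators `a, b` of `BS(p,q)`. -/
def bsGen (p q : ℕ) : Fin 2 → BS p q := fun i => PresentedGroup.of i

/-- Thompson's group `F = ⟨a, b ∣ [a b⁻¹, a⁻¹ b a], [a b⁻¹, a⁻² b a²]⟩`,
where `[x, y] = x y x⁻¹ y⁻¹`. -/
abbrev ThompsonF : Type :=
  PresentedGroup ({⁅fa * fb⁻¹, fa⁻¹ * fb * fa⁆,
    ⁅fa * fb⁻¹, (fa ^ 2)⁻¹ * fb * fa ^ 2⁆} : Set (FreeGroup (Fin 2)))

/-- The generators `a, b` of Thompson's group `F`. -/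
def thompsonGen : Fin 2 → ThompsonF := fun i => PresentedGroup.of i

end Cogrowth

end

/-! Lower bounds on ρ come from Rayleigh quotients. A finite graph with edges labelled by the
generators is mapped to the Cayley graph so that each vertex has at most one outgoing and one
incoming edge of each label. Then walks from a fixed vertex spell distinct words. The adjacency
operator A is self-adjoint, so a test function f with ⟨f, Af⟩ ≥ l⟨f, f⟩ satisfies ⟨f, A^n f⟩ ≥
l^n⟨f, f⟩ for n = 2^k. The graph being finite, some group element is then the value of at least
const · l^n words of length n. Joining one such word to the inverse of another gives trivial words
of length 2n, so l ≤ ρ (`le_rho_of_rayleigh`). The map to the group need not be injective on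
vertices, so no normal forms or solution of the word problem are needed: the defining relations
suffice.

For F the vertices are pointed forests of binary trees: a moves the pointer over a tree and b
removes the root caret of the tree at the pointer. A product of tree weights ψ with Σψ² = 1 gives
quotients tending to 2 + 2 Σ ψ(t)ψ(u)ψ(node t u) (`le_rho_of_forestState`). For BS(p,q) the graph is
a finite piece of the tree of a-lines; the test function is a periodic profile on each line times a
product of transition amplitudes (`le_rho_of_lineState`).

The bounds on α follow from ρ ≤ α + 3/α (`le_alpha_of_lt_rho`), proved by sorting trivial words by
their free reductions. -/

namespace Cogrowth

open Filter Topology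

/-! ### Counting words by value, and bounds on ρ from such counts. -/

section Counting

variable {G ι : Type} [Group G]

/-- The value of a single letter. -/
noncomputable def letterValue (s : ι → G) (x : ι × Bool) : G :=
  if x.2 then s x.1 else (s x.1)⁻¹

/-- The number of words of length `n` with value `h`. -/
noncomputable def numWords (s : ι → G) (n : ℕ) (h : G) : ℕ :=
  {w : List (ι × Bool) | w.length = n ∧ wordValue s w = h}.ncard

theorem wordValue_nil (s : ι → G) : wordValue s [] = 1 := rfl

theorem wordValue_cons (s : ι → G) (x : ι × Bool) (w : List (ι × Bool)) :
    wordValue s (x :: w) = letterValue s x * wordValue s w := by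
  simp [wordValue, letterValue]

theorem wordValue_eq_lift (s : ι → G) (w : List (ι × Bool)) :
    wordValue s w = FreeGroup.lift s (FreeGroup.mk w) := by
  rw [FreeGroup.lift_mk]
  simp only [wordValue]
  congr 2
  ext x
  cases x.2 <;> rfl

theorem wordValue_append (s : ι → G) (v w : List (ι × Bool)) :
    wordValue s (v ++ w) = wordValue s v * wordValue s w := by
  simp [wordValue]

theorem wordValue_invRev (s : ι → G) (w : List (ι × Bool)) :
    wordValue s (FreeGroup.invRev w) = (wordValue s w)⁻¹ := by
  rw [wordValue_eq_lift, wordValue_eq_lift, ← FreeGroup.inv_mk, map_inv]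

theorem wordsOfValue_finite [Finite ι] (s : ι → G) (n : ℕ) (h : G) :
    {w : List (ι × Bool) | w.length = n ∧ wordValue s w = h}.Finite :=
  (List.finite_length_eq (ι × Bool) n).subset fun _ h => h.1

theorem numWords_zero (s : ι → G) (h : G) [Decidable (h = 1)] :
    numWords s 0 h = if h = 1 then 1 else 0 := by
  unfold numWords
  split_ifs with hh
  · have : {w : List (ι × Bool) | w.length = 0 ∧ wordValue s w = h} = {[]} := by
      ext w
      simp only [List.length_eq_zero_iff, Set.mem_ofPred_eq, Set.mem_singleton_iff]
      constructor
      · exact fun hw => hw.1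
      · rintro rfl
        exact ⟨rfl, hh.symm⟩
    rw [this, Set.ncard_singleton]
  · have : {w : List (ι × Bool) | w.length = 0 ∧ wordValue s w = h} = ∅ := by
      ext w
      simp only [List.length_eq_zero_iff, Set.mem_ofPred_eq, Set.mem_empty_iff_false, iff_false]
      rintro ⟨rfl, hw⟩
      exact hh hw.symm
    rw [this, Set.ncard_empty]

theorem numWords_succ [Fintype ι] (s : ι → G) (n : ℕ) (h : G) :
    numWords s (n + 1) h = ∑ x : ι × Bool, numWords s n ((letterValue s x)⁻¹ * h) := by
  let e : {w : List (ι × Bool) | w.length = n + 1 ∧ wordValue s w = h} ≃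
      Σ x : ι × Bool,
        {w : List (ι × Bool) | w.length = n ∧ wordValue s w = (letterValue s x)⁻¹ * h} :=
    { toFun := fun w => match w with
        | ⟨[], hw⟩ => absurd hw.1 (by simp)
        | ⟨x :: w, hw⟩ => ⟨x, w, by simpa using hw.1, by
            rw [eq_inv_mul_iff_mul_eq, ← wordValue_cons]; exact hw.2⟩
      invFun := fun w => ⟨w.1 :: w.2.1, by simpa using w.2.2.1, by
        rw [wordValue_cons, ← eq_inv_mul_iff_mul_eq]; exact w.2.2.2⟩
      left_inv := by
        rintro ⟨_ | ⟨x, w⟩, hw⟩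
        · exact absurd hw.1 (by simp)
        · rfl
      right_inv := by rintro ⟨x, w, hw⟩; rfl }
  have hfin : ∀ x : ι × Bool, Finite
      {w : List (ι × Bool) | w.length = n ∧ wordValue s w = (letterValue s x)⁻¹ * h} :=
    fun x => (wordsOfValue_finite s n _).to_subtype
  unfold numWords
  rw [← Nat.card_coe_set_eq, Nat.card_congr e, Nat.card_sigma]
  rfl

/-- Two words of length `n` with the same value give a trivial word of length `2 * n`. -/
theorem numWords_sq_le [Finite ι] (s : ι → G) (n : ℕ) (h : G) :
    numWords s n h ^ 2 ≤ numReturns s (2 * n) := by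
  rw [sq, numWords, ← Set.ncard_prod]
  refine Set.ncard_le_ncard_of_injOn (fun p => p.1 ++ FreeGroup.invRev p.2) ?_ ?_
    (returns_finite s _)
  · rintro ⟨v, w⟩ ⟨⟨hv, hv'⟩, hw, hw'⟩
    refine ⟨?_, ?_⟩
    · simp only [List.length_append, FreeGroup.invRev_length]
      simp only at hv hw
      omega
    · simp only at hv' hw'
      simp only [wordValue_append, wordValue_invRev, hv', hw', mul_inv_cancel]
  · rintro ⟨v, w⟩ ⟨⟨hv, -⟩, -⟩ ⟨v', w'⟩ ⟨⟨hv', -⟩, -⟩ heq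
    simp only at hv hv' heq
    obtain ⟨h1, h2⟩ := List.append_inj heq (hv.trans hv'.symm)
    exact Prod.ext h1 (FreeGroup.invRev_injective h2)

theorem numReturns_rpow_le [Fintype ι] (s : ι → G) (n : ℕ) :
    (numReturns s n : ℝ) ^ (1 / (n : ℝ)) ≤ max 1 (2 * (Fintype.card ι : ℝ)) := by
  rcases Nat.eq_zero_or_pos n with rfl | hn
  · simp
  · refine le_max_of_le_right ?_
    have h : (numReturns s n : ℝ) ≤ (2 * Fintype.card ι : ℝ) ^ n := by
      exact_mod_cast numReturns_le s n
    calc (numReturns s n : ℝ) ^ (1 / (n : ℝ)) ≤ ((2 * Fintype.card ι : ℝ) ^ n) ^ (1 / (n : ℝ)) := by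
          gcongr
      _ = 2 * Fintype.card ι := by
          rw [one_div, Real.pow_rpow_inv_natCast (by positivity) hn.ne']

theorem numReturns_isBoundedUnder [Fintype ι] (s : ι → G) :
    IsBoundedUnder (· ≤ ·) atTop fun n : ℕ => (numReturns s n : ℝ) ^ (1 / (n : ℝ)) :=
  isBoundedUnder_of ⟨_, numReturns_rpow_le s⟩

theorem numReturns_isCoboundedUnder (s : ι → G) :
    IsCoboundedUnder (· ≤ ·) atTop fun n : ℕ => (numReturns s n : ℝ) ^ (1 / (n : ℝ)) :=
  IsBoundedUnder.isCoboundedUnder_le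
    (isBoundedUnder_of ⟨0, fun _ => by positivity⟩)

/-- A lower bound `c * l ^ n` on the number of words with some common value, for infinitely many
lengths `n`, bounds `ρ` from below. -/
theorem le_rho_of_frequently [Fintype ι] (s : ι → G) {c l : ℝ} (hc : 0 < c) (hl : 0 ≤ l)
    (h : ∃ᶠ n in atTop, ∃ x, c * l ^ n ≤ numWords s n x) : l ≤ rho s := by
  have hlim : Tendsto (fun n : ℕ => c ^ (1 / (n : ℝ)) * l) atTop (𝓝 l) := by
    have h0 : Tendsto (fun n : ℕ => c ^ (1 / (n : ℝ))) atTop (𝓝 (c ^ (0 : ℝ))) :=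
      (Real.continuousAt_const_rpow hc.ne').tendsto.comp tendsto_one_div_atTop_nhds_zero_nat
    simpa using h0.mul_const l
  refine le_of_forall_lt fun m hm => ?_
  obtain ⟨m', hm', hm'l⟩ := exists_between hm
  refine lt_of_lt_of_le hm' ?_
  unfold rho
  refine le_limsup_of_frequently_le ?_ (numReturns_isBoundedUnder s)
  have h2 : Tendsto (fun n : ℕ => 2 * n) atTop atTop :=
    tendsto_id.const_mul_atTop' (by norm_num : (0 : ℕ) < 2)
  -- Pass to lengths 2n, where the squared bound holds; the constant disappears because c^(1/n) → 1.
  refine h2.frequently ?_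
  refine (h.and_eventually ((hlim.eventually (lt_mem_nhds hm'l)).and
    (eventually_gt_atTop 0))).mono ?_
  rintro n ⟨⟨x, hx⟩, hn, hn0⟩
  have h3 : (c * l ^ n) ^ 2 ≤ (numReturns s (2 * n) : ℝ) := by
    have : (numWords s n x : ℝ) ^ 2 ≤ numReturns s (2 * n) := by
      exact_mod_cast numWords_sq_le s n x
    refine le_trans ?_ this
    gcongr
  have h4 : ((c * l ^ n) ^ 2) ^ (1 / ((2 * n : ℕ) : ℝ)) = c ^ (1 / (n : ℝ)) * l := by
    have e1 : ((c * l ^ n) ^ 2) = (c ^ (1 / (n : ℝ)) * l) ^ (2 * n) := by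
      rw [mul_comm 2 n, pow_mul, mul_pow (c ^ (1 / (n : ℝ))) l n, one_div,
        Real.rpow_inv_natCast_pow hc.le hn0.ne']
    rw [e1, one_div ((2 * n : ℕ) : ℝ), Real.pow_rpow_inv_natCast (by positivity) (by omega)]
  calc m' ≤ c ^ (1 / (n : ℝ)) * l := hn.le
    _ = ((c * l ^ n) ^ 2) ^ (1 / ((2 * n : ℕ) : ℝ)) := h4.symm
    _ ≤ _ := by gcongr

end Counting

/-! ### Rayleigh quotients of labelled graphs over a Cayley graph. -/

section Rayleigh

variable {G ι V : Type} [Group G] [Fintype ι] [DecidableEq V]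

/-- The adjacency operator of a finite graph with edges labelled by `ι`. -/
def adjOp (E : ι → Finset (V × V)) (F : V → ℝ) (x : V) : ℝ :=
  ∑ i, ((∑ e ∈ E i with e.1 = x, F e.2) + ∑ e ∈ E i with e.2 = x, F e.1)

/-- Each edge is met once from either end. The right side is symmetric in `F` and `H`, which gives
self-adjointness. -/
theorem sum_mul_adjOp (E : ι → Finset (V × V)) (S : Finset V)
    (hS : ∀ i, ∀ e ∈ E i, e.1 ∈ S ∧ e.2 ∈ S) (F H : V → ℝ) :
    ∑ x ∈ S, F x * adjOp E H x = ∑ i, ∑ e ∈ E i, (F e.1 * H e.2 + F e.2 * H e.1) := by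
  simp only [adjOp, Finset.mul_sum]
  rw [Finset.sum_comm]
  refine Finset.sum_congr rfl fun i _ => ?_
  simp only [mul_add, Finset.mul_sum, Finset.sum_add_distrib]
  congr 1
  · rw [← Finset.sum_fiberwise_of_maps_to (fun e he => (hS i e he).1)]
    refine Finset.sum_congr rfl fun x _ => Finset.sum_congr rfl fun e he => ?_
    rw [(Finset.mem_filter.1 he).2]
  · rw [← Finset.sum_fiberwise_of_maps_to (fun e he => (hS i e he).2)]
    refine Finset.sum_congr rfl fun x _ => Finset.sum_congr rfl fun e he => ?_
    rw [(Finset.mem_filter.1 he).2]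

theorem sum_mul_adjOp_comm (E : ι → Finset (V × V)) (S : Finset V)
    (hS : ∀ i, ∀ e ∈ E i, e.1 ∈ S ∧ e.2 ∈ S) (F H : V → ℝ) :
    ∑ x ∈ S, F x * adjOp E H x = ∑ x ∈ S, adjOp E F x * H x := by
  have : ∑ x ∈ S, adjOp E F x * H x = ∑ x ∈ S, H x * adjOp E F x :=
    Finset.sum_congr rfl fun x _ => mul_comm _ _
  rw [this, sum_mul_adjOp E S hS, sum_mul_adjOp E S hS]
  refine Finset.sum_congr rfl fun i _ => Finset.sum_congr rfl fun e _ => by ring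

theorem sum_mul_adjOp_iterate (E : ι → Finset (V × V)) (S : Finset V)
    (hS : ∀ i, ∀ e ∈ E i, e.1 ∈ S ∧ e.2 ∈ S) (m n : ℕ) (F H : V → ℝ) :
    ∑ x ∈ S, F x * (adjOp E)^[m + n] H x =
      ∑ x ∈ S, (adjOp E)^[m] F x * (adjOp E)^[n] H x := by
  induction m generalizing n H with
  | zero => simp
  | succ m ih =>
    rw [Function.iterate_succ_apply' (adjOp E) m F, ← sum_mul_adjOp_comm E S hS,
      ← Function.iterate_succ_apply' (adjOp E) n H, ← ih]
    congr! 3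
    omega

/-- Iterated Cauchy–Schwarz for the moments of the adjacency operator. -/
theorem pow_mul_le_sum_adjOp_iterate (E : ι → Finset (V × V)) (S : Finset V)
    (hS : ∀ i, ∀ e ∈ E i, e.1 ∈ S ∧ e.2 ∈ S) (F : V → ℝ) {l : ℝ} (hl : 0 ≤ l)
    (hpos : 0 < ∑ x ∈ S, F x ^ 2)
    (h : l * ∑ x ∈ S, F x ^ 2 ≤ ∑ x ∈ S, F x * adjOp E F x) (k : ℕ) :
    l ^ 2 ^ k * ∑ x ∈ S, F x ^ 2 ≤ ∑ x ∈ S, F x * (adjOp E)^[2 ^ k] F x := by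
  induction k with
  | zero => simpa using h
  | succ k ih =>
    set N := ∑ x ∈ S, F x ^ 2
    have e : ∑ x ∈ S, F x * (adjOp E)^[2 ^ (k + 1)] F x =
        ∑ x ∈ S, (adjOp E)^[2 ^ k] F x ^ 2 := by
      rw [pow_succ, mul_two, sum_mul_adjOp_iterate E S hS]
      simp only [sq]
    have cs := Finset.sum_mul_sq_le_sq_mul_sq S F ((adjOp E)^[2 ^ k] F)
    rw [e]
    have h1 : (l ^ 2 ^ k * N) ^ 2 ≤ N * ∑ x ∈ S, (adjOp E)^[2 ^ k] F x ^ 2 := by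
      refine le_trans ?_ cs
      gcongr
    have h2 : (l ^ 2 ^ k * N) ^ 2 = N * (l ^ 2 ^ (k + 1) * N) := by
      rw [pow_succ 2 k, pow_mul]; ring
    rw [h2] at h1
    exact le_of_mul_le_mul_left h1 hpos

/-- Used for the inner sums of `adjOp`: an injective endpoint map leaves at most one edge at a
vertex, and `0 ≤ c` covers the case of none. -/
theorem sum_filter_le_of_injOn {α β : Type} [DecidableEq β] (E : Finset α) (p : α → β)
    (hp : Set.InjOn p E) (x : β) (F : α → ℝ) (c : ℝ) (hc : 0 ≤ c)
    (h : ∀ e ∈ E, p e = x → F e ≤ c) : ∑ e ∈ E with p e = x, F e ≤ c := by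
  by_cases hne : ∃ e ∈ E, p e = x
  · obtain ⟨e, he, hx⟩ := hne
    have : E.filter (fun e => p e = x) = {e} := by
      ext e'
      simp only [Finset.mem_filter, Finset.mem_singleton]
      constructor
      · rintro ⟨he', hx'⟩
        exact hp he' he (hx'.trans hx.symm)
      · rintro rfl
        exact ⟨he, hx⟩
    rw [this, Finset.sum_singleton]
    exact h e he hx
  · rw [Finset.filter_eq_empty_iff.2 fun e he hx => hne ⟨e, he, hx⟩]
    simpa using hc

/-- A walk from `x` to `y` spells a word with value `(g x)⁻¹ * g y`, and the injectivity hypotheses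
make the walk recoverable from `x` and the word. The induction removes the first letter. -/
theorem adjOp_iterate_le (s : ι → G) (g : V → G) (S : Finset V) (E : ι → Finset (V × V))
    (hS : ∀ i, ∀ e ∈ E i, e.1 ∈ S ∧ e.2 ∈ S) (hg : ∀ i, ∀ e ∈ E i, g e.2 = g e.1 * s i)
    (hfst : ∀ i, Set.InjOn Prod.fst (E i : Set (V × V)))
    (hsnd : ∀ i, Set.InjOn Prod.snd (E i : Set (V × V)))
    (f : V → ℝ) (hf : ∀ x, 0 ≤ f x) (n : ℕ) (x : V) (hx : x ∈ S) :
    (adjOp E)^[n] f x ≤ ∑ y ∈ S, f y * numWords s n ((g x)⁻¹ * g y) := by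
  classical
  induction n generalizing x with
  | zero =>
    refine le_trans ?_ (Finset.single_le_sum (f := fun y => f y * numWords s 0 ((g x)⁻¹ * g y))
      (fun y _ => mul_nonneg (hf y) (Nat.cast_nonneg _)) hx)
    simp [numWords_zero]
  | succ n ih =>
    rw [Function.iterate_succ_apply']
    have e : ∑ y ∈ S, f y * (numWords s (n + 1) ((g x)⁻¹ * g y) : ℝ) =
        ∑ i : ι, ((∑ y ∈ S, f y * (numWords s n ((g x * s i)⁻¹ * g y) : ℝ)) +
          ∑ y ∈ S, f y * (numWords s n ((g x * (s i)⁻¹)⁻¹ * g y) : ℝ)) := by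
      rw [← Finset.sum_add_distrib.symm, Finset.sum_comm, Finset.sum_comm (s := Finset.univ),
        ← Finset.sum_add_distrib]
      refine Finset.sum_congr rfl fun y _ => ?_
      rw [numWords_succ, Fintype.sum_prod_type]
      simp only [Fintype.sum_bool, letterValue, if_true, Bool.false_eq_true, if_false,
        Nat.cast_sum, Nat.cast_add, Finset.sum_add_distrib, mul_add, Finset.mul_sum, mul_inv_rev,
        mul_assoc]
    rw [e, adjOp]
    refine Finset.sum_le_sum fun i _ => add_le_add ?_ ?_
    · refine sum_filter_le_of_injOn (E i) Prod.fst (hfst i) x _ _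
        (Finset.sum_nonneg fun y _ => mul_nonneg (hf y) (Nat.cast_nonneg _)) ?_
      rintro ⟨u, v⟩ he rfl
      have := ih v (hS i _ he).2
      rwa [hg i _ he] at this
    · refine sum_filter_le_of_injOn (E i) Prod.snd (hsnd i) x _ _
        (Finset.sum_nonneg fun y _ => mul_nonneg (hf y) (Nat.cast_nonneg _)) ?_
      rintro ⟨u, v⟩ he rfl
      have := ih u (hS i _ he).1
      rwa [show g u = g v * (s i)⁻¹ from by rw [hg i _ he]; simp] at this

/-- **Rayleigh quotient bound.** A finite labelled graph that maps to the Cayley graph of `G`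
without folding bounds `ρ` from below by the Rayleigh quotients of its adjacency operator. -/
theorem le_rho_of_rayleigh (s : ι → G) (g : V → G) (S : Finset V) (E : ι → Finset (V × V))
    (hS : ∀ i, ∀ e ∈ E i, e.1 ∈ S ∧ e.2 ∈ S) (hg : ∀ i, ∀ e ∈ E i, g e.2 = g e.1 * s i)
    (hfst : ∀ i, Set.InjOn Prod.fst (E i : Set (V × V)))
    (hsnd : ∀ i, Set.InjOn Prod.snd (E i : Set (V × V)))
    (f : V → ℝ) (hf : ∀ x, 0 ≤ f x) (hpos : 0 < ∑ x ∈ S, f x ^ 2) {l : ℝ}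
    (h : l * ∑ x ∈ S, f x ^ 2 ≤ 2 * ∑ i, ∑ e ∈ E i, f e.1 * f e.2) : l ≤ rho s := by
  wlog hl : 0 ≤ l generalizing l
  · refine (le_of_not_ge hl).trans (this ?_ le_rfl)
    rw [zero_mul]
    exact mul_nonneg zero_le_two (Finset.sum_nonneg fun i _ => Finset.sum_nonneg fun e _ =>
      mul_nonneg (hf _) (hf _))
  set N := ∑ x ∈ S, f x ^ 2
  have hray : l * N ≤ ∑ x ∈ S, f x * adjOp E f x := by
    rw [sum_mul_adjOp E S hS]
    refine h.trans (le_of_eq ?_)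
    simp only [Finset.mul_sum]
    exact Finset.sum_congr rfl fun i _ => Finset.sum_congr rfl fun e _ => by ring
  -- `N / C` is the constant for which the bounds `numWords < N / C * l ^ n`, averaged with weights
  -- `f x * f y`, contradict the moment bound `l ^ n * N`.
  set C := ∑ x ∈ S, ∑ y ∈ S, f x * f y
  have hC : 0 < C := by
    have h1 : C = (∑ x ∈ S, f x) ^ 2 := by rw [sq, Finset.sum_mul_sum]
    have h2 : 0 < ∑ x ∈ S, f x := by
      refine lt_of_le_of_ne (Finset.sum_nonneg fun x _ => hf x) fun h0 => ?_
      rw [eq_comm, Finset.sum_eq_zero_iff_of_nonneg fun x _ => hf x] at h0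
      refine hpos.ne' (Finset.sum_eq_zero fun x hx => ?_)
      rw [h0 x hx]
      norm_num
    rw [h1]
    positivity
  refine le_rho_of_frequently s (c := N / C) (by positivity) hl ?_
  have h2 : Tendsto (fun k : ℕ => 2 ^ k) atTop (atTop : Filter ℕ) :=
    tendsto_pow_atTop_atTop_of_one_lt one_lt_two
  refine h2.frequently (Frequently.of_forall fun k => ?_)
  by_contra hno
  push Not at hno
  have h3 := pow_mul_le_sum_adjOp_iterate E S hS f hl hpos hray k
  have h4 : ∑ x ∈ S, f x * (adjOp E)^[2 ^ k] f x ≤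
      ∑ x ∈ S, ∑ y ∈ S, f x * f y * (numWords s (2 ^ k) ((g x)⁻¹ * g y) : ℝ) := by
    refine Finset.sum_le_sum fun x hx => ?_
    refine (mul_le_mul_of_nonneg_left
      (adjOp_iterate_le s g S E hS hg hfst hsnd f hf (2 ^ k) x hx) (hf x)).trans (le_of_eq ?_)
    rw [Finset.mul_sum]
    exact Finset.sum_congr rfl fun y _ => by ring
  obtain ⟨x₀, hx₀, hfx⟩ : ∃ x ∈ S, 0 < f x := by
    by_contra hz
    push Not at hz
    refine hpos.ne' (Finset.sum_eq_zero fun x hx => ?_)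
    rw [le_antisymm (hz x hx) (hf x)]
    norm_num
  have h5 : ∑ x ∈ S, ∑ y ∈ S, f x * f y * (numWords s (2 ^ k) ((g x)⁻¹ * g y) : ℝ) <
      ∑ x ∈ S, ∑ y ∈ S, f x * f y * (N / C * l ^ 2 ^ k) := by
    have hle : ∀ x y, f x * f y * (numWords s (2 ^ k) ((g x)⁻¹ * g y) : ℝ) ≤
        f x * f y * (N / C * l ^ 2 ^ k) := fun x y =>
      mul_le_mul_of_nonneg_left (hno _).le (mul_nonneg (hf x) (hf y))
    refine Finset.sum_lt_sum (fun x _ => Finset.sum_le_sum fun y _ => hle x y) ⟨x₀, hx₀, ?_⟩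
    exact Finset.sum_lt_sum (fun y _ => hle x₀ y) ⟨x₀, hx₀,
      mul_lt_mul_of_pos_left (hno _) (mul_pos hfx hfx)⟩
  have h6 : ∑ x ∈ S, ∑ y ∈ S, f x * f y * (N / C * l ^ 2 ^ k) = l ^ 2 ^ k * N := by
    simp only [← Finset.sum_mul]
    change C * _ = _
    field_simp
  linarith

/-- The Rayleigh quotient bound for two generators, with edges given as indexed families. -/
theorem le_rho_of_edge_families {κ₀ κ₁ : Type} (s : Fin 2 → G) (g : V → G) (S : Finset V)
    (A : Finset κ₀) (a₁ a₂ : κ₀ → V) (B : Finset κ₁) (b₁ b₂ : κ₁ → V)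
    (hAS : ∀ e ∈ A, a₁ e ∈ S ∧ a₂ e ∈ S) (hBS : ∀ e ∈ B, b₁ e ∈ S ∧ b₂ e ∈ S)
    (hAg : ∀ e ∈ A, g (a₂ e) = g (a₁ e) * s 0) (hBg : ∀ e ∈ B, g (b₂ e) = g (b₁ e) * s 1)
    (ha₁ : Set.InjOn a₁ A) (ha₂ : Set.InjOn a₂ A) (hb₁ : Set.InjOn b₁ B) (hb₂ : Set.InjOn b₂ B)
    (f : V → ℝ) (hf : ∀ x, 0 ≤ f x) (hpos : 0 < ∑ x ∈ S, f x ^ 2) {l : ℝ}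
    (h : l * ∑ x ∈ S, f x ^ 2 ≤
      2 * (∑ e ∈ A, f (a₁ e) * f (a₂ e) + ∑ e ∈ B, f (b₁ e) * f (b₂ e))) : l ≤ rho s := by
  refine le_rho_of_rayleigh s g S
    ![A.image fun e => (a₁ e, a₂ e), B.image fun e => (b₁ e, b₂ e)] ?_ ?_ ?_ ?_ f hf hpos ?_
  · simp only [Fin.forall_fin_two, Matrix.cons_val_zero, Matrix.cons_val_one,
      Matrix.cons_val_fin_one, Finset.forall_mem_image]
    exact ⟨hAS, hBS⟩
  · simp only [Fin.forall_fin_two, Matrix.cons_val_zero, Matrix.cons_val_one,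
      Matrix.cons_val_fin_one, Finset.forall_mem_image]
    exact ⟨hAg, hBg⟩
  · rw [Fin.forall_fin_two]
    constructor
    · rintro _ hx _ hy hxy
      simp only [Matrix.cons_val_zero, Finset.coe_image, Set.mem_image] at hx hy
      obtain ⟨e, he, rfl⟩ := hx
      obtain ⟨e', he', rfl⟩ := hy
      rw [ha₁ he he' hxy]
    · rintro _ hx _ hy hxy
      simp only [Matrix.cons_val_one, Matrix.cons_val_fin_one, Finset.coe_image,
        Set.mem_image] at hx hy
      obtain ⟨e, he, rfl⟩ := hx
      obtain ⟨e', he', rfl⟩ := hy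
      rw [hb₁ he he' hxy]
  · rw [Fin.forall_fin_two]
    constructor
    · rintro _ hx _ hy hxy
      simp only [Matrix.cons_val_zero, Finset.coe_image, Set.mem_image] at hx hy
      obtain ⟨e, he, rfl⟩ := hx
      obtain ⟨e', he', rfl⟩ := hy
      rw [ha₂ he he' hxy]
    · rintro _ hx _ hy hxy
      simp only [Matrix.cons_val_one, Matrix.cons_val_fin_one, Finset.coe_image,
        Set.mem_image] at hx hy
      obtain ⟨e, he, rfl⟩ := hx
      obtain ⟨e', he', rfl⟩ := hy
      rw [hb₂ he he' hxy]
  · refine h.trans (le_of_eq ?_)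
    rw [Fin.sum_univ_two]
    simp only [Matrix.cons_val_zero, Matrix.cons_val_one, Matrix.cons_val_fin_one]
    rw [Finset.sum_image fun x hx y hy hxy => ha₁ hx hy (congrArg Prod.fst hxy),
      Finset.sum_image fun x hx y hy hxy => hb₁ hx hy (congrArg Prod.fst hxy)]

end Rayleigh

open Filter Topology

/-! ### Free reduction and the passage from ρ to α. -/

section FreeReduction

variable {G : Type} [Group G]

theorem wordValue_freeGroup {ι : Type} (w : List (ι × Bool)) :
    wordValue (FreeGroup.of : ι → FreeGroup ι) w = FreeGroup.mk w := by
  rw [wordValue_eq_lift, FreeGroup.lift_of_eq_id, MonoidHom.id_apply]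

theorem norm_letterValue_inv_mul {ι : Type} [DecidableEq ι] (x : FreeGroup ι) (y : ι × Bool) :
    ((letterValue FreeGroup.of y)⁻¹ * x).norm =
      match x.toWord with
      | [] => 1
      | h :: t => if y = h then t.length else t.length + 2 := by
  have e : (letterValue FreeGroup.of y)⁻¹ * x = FreeGroup.mk ((y.1, !y.2) :: x.toWord) := by
    have h1 : letterValue FreeGroup.of y = FreeGroup.mk [y] := by
      rw [← wordValue_freeGroup, wordValue_cons, wordValue_nil, mul_one]
    rw [h1, FreeGroup.inv_mk]
    conv_lhs => rw [← FreeGroup.mk_toWord (x := x), FreeGroup.mul_mk]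
    rfl
  rw [FreeGroup.norm, e, FreeGroup.toWord_mk, FreeGroup.reduce.cons, FreeGroup.reduce_toWord]
  cases x.toWord with
  | nil => rfl
  | cons h t =>
    obtain ⟨y1, y2⟩ := y
    obtain ⟨h1, h2⟩ := h
    by_cases hy : y1 = h1 ∧ y2 = h2
    · simp [hy.1, hy.2]
    · simp [hy]

/-- In the 4-regular tree a vertex other than the root has one neighbour nearer the root and three
farther, giving equality. At the root the claim is 4/c ≤ c + 3/c, which is where `1 ≤ c` enters. -/
theorem sum_inv_pow_norm_le {c : ℝ} (hc : 1 ≤ c) (x : FreeGroup (Fin 2)) :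
    ∑ y : Fin 2 × Bool, c⁻¹ ^ ((letterValue FreeGroup.of y)⁻¹ * x).norm ≤
      (c + 3 / c) * c⁻¹ ^ x.norm := by
  have hc0 : 0 < c := by linarith
  simp only [norm_letterValue_inv_mul]
  rw [FreeGroup.norm]
  cases x.toWord with
  | nil =>
    simp only [Finset.sum_const, Finset.card_univ, Fintype.card_prod, Fintype.card_fin,
      Fintype.card_bool, List.length_nil, pow_zero, mul_one, pow_one, nsmul_eq_mul]
    have : c⁻¹ ≤ c := (inv_le_one_of_one_le₀ hc).trans hc
    rw [div_eq_mul_inv]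
    push_cast
    linarith
  | cons h t =>
    have e : ∀ y : Fin 2 × Bool, c⁻¹ ^ (if y = h then t.length else t.length + 2) =
        c⁻¹ ^ (t.length + 2) + if y = h then c⁻¹ ^ t.length - c⁻¹ ^ (t.length + 2) else 0 := by
      intro y
      split_ifs <;> ring
    simp only [e, Finset.sum_add_distrib, Finset.sum_ite_eq', Finset.mem_univ, if_true,
      Finset.sum_const, Finset.card_univ, Fintype.card_prod, Fintype.card_fin,
      Fintype.card_bool, nsmul_eq_mul, List.length_cons]
    refine le_of_eq ?_
    push_cast
    simp only [inv_pow]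
    field_simp
    ring

/-- The number of words of length `n` that freely reduce to a given element. -/
theorem numWords_freeGroup_le {c : ℝ} (hc : 1 ≤ c) (n : ℕ) (x : FreeGroup (Fin 2)) :
    (numWords FreeGroup.of n x : ℝ) ≤ (c + 3 / c) ^ n * c⁻¹ ^ x.norm := by
  classical
  have hc0 : 0 < c := by linarith
  induction n generalizing x with
  | zero =>
    rw [numWords_zero]
    split_ifs with h
    · simp [h]
    · simp only [Nat.cast_zero, pow_zero, one_mul]
      positivity
  | succ n ih =>
    rw [numWords_succ]
    push_cast
    calc _ ≤ ∑ y : Fin 2 × Bool,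
          (c + 3 / c) ^ n * c⁻¹ ^ ((letterValue FreeGroup.of y)⁻¹ * x).norm :=
          Finset.sum_le_sum fun y _ => ih _
      _ ≤ (c + 3 / c) ^ n * ((c + 3 / c) * c⁻¹ ^ x.norm) := by
          rw [← Finset.mul_sum]
          exact mul_le_mul_of_nonneg_left (sum_inv_pow_norm_le hc x) (by positivity)
      _ = _ := by ring

theorem reducedReturns_finite {ι : Type} [Finite ι] (s : ι → G) (n : ℕ) :
    (reducedReturns s n).Finite :=
  (returns_finite s n).subset fun _ h => h.1

/-- A trivial word reduces to a reduced trivial word of some length k ≤ n, and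
`numWords_freeGroup_le` bounds how many words of length n share that reduction. -/
theorem numReturns_le_sum_numReducedReturns (s : Fin 2 → G) {c : ℝ} (hc : 1 ≤ c) (n : ℕ) :
    (numReturns s n : ℝ) ≤
      ∑ k ∈ Finset.range (n + 1), numReducedReturns s k * ((c + 3 / c) ^ n * c⁻¹ ^ k) := by
  classical
  have hc0 : 0 < c := by linarith
  set R := (returns_finite s n).toFinset
  set T : ℕ → Finset (List (Fin 2 × Bool)) := fun k => (reducedReturns_finite s k).toFinset
  have hR : numReturns s n = R.card := Set.ncard_eq_toFinset_card _ (returns_finite s n)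
  have hT : ∀ k, numReducedReturns s k = (T k).card :=
    fun k => Set.ncard_eq_toFinset_card _ (reducedReturns_finite s k)
  have hmaps : ∀ w ∈ R, FreeGroup.reduce w ∈ (Finset.range (n + 1)).biUnion T := by
    intro w hw
    obtain ⟨hwn, hw1⟩ := (Set.Finite.mem_toFinset _).1 hw
    refine Finset.mem_biUnion.2 ⟨(FreeGroup.reduce w).length, ?_, ?_⟩
    · have := FreeGroup.norm_mk_le (L₁ := w)
      rw [FreeGroup.norm, FreeGroup.toWord_mk] at this
      exact Finset.mem_range.2 (by omega)
    · refine (Set.Finite.mem_toFinset _).2 ⟨⟨rfl, ?_⟩, ?_⟩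
      · rw [wordValue_eq_lift, FreeGroup.reduce.self, ← wordValue_eq_lift, hw1]
      · exact FreeGroup.isReduced_iff_reduce_eq.2 FreeGroup.reduce.idem
  have hfib : ∀ u, ((R.filter fun w => FreeGroup.reduce w = u).card : ℝ) ≤
      numWords FreeGroup.of n (FreeGroup.mk u) := by
    intro u
    rw [Nat.cast_le, numWords, ← Set.ncard_coe_finset]
    refine Set.ncard_le_ncard ?_ (wordsOfValue_finite _ n _)
    intro w hw
    obtain ⟨hw1, rfl⟩ := Finset.mem_filter.1 (Finset.mem_coe.1 hw)
    refine ⟨((Set.Finite.mem_toFinset _).1 hw1).1, ?_⟩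
    rw [wordValue_freeGroup, FreeGroup.reduce.self]
  rw [hR, Finset.card_eq_sum_card_fiberwise hmaps, Nat.cast_sum]
  refine (Finset.sum_le_sum fun u _ => hfib u).trans ?_
  refine (Finset.sum_le_sum fun u _ => numWords_freeGroup_le hc n _).trans ?_
  rw [Finset.sum_biUnion]
  swap
  · intro k _ k' _ hkk'
    refine Finset.disjoint_left.2 fun u hu hu' => hkk' ?_
    exact ((Set.Finite.mem_toFinset _).1 hu).1.1.symm.trans ((Set.Finite.mem_toFinset _).1 hu').1.1
  refine Finset.sum_le_sum fun k _ => ?_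
  rw [hT, ← nsmul_eq_mul, ← Finset.sum_const]
  refine Finset.sum_le_sum fun u hu => le_of_eq ?_
  obtain ⟨⟨hk, -⟩, hred⟩ := (Set.Finite.mem_toFinset _).1 hu
  rw [FreeGroup.norm, FreeGroup.toWord_mk, hred.reduce_eq, hk]

/-- One half of the cogrowth formula: `ρ ≤ α + 3 / α`. -/
theorem le_alpha_of_lt_rho (s : Fin 2 → G) {c : ℝ} (hc : 1 ≤ c) (h : c + 3 / c < rho s) :
    c ≤ alpha s := by
  have hc0 : 0 < c := by linarith
  set μ := c + 3 / c
  have hμ : 0 < μ := by positivity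
  -- If α < c, then p_k c^(-k) is bounded, so r_n is at most a linear factor times μ^n. This
  -- contradicts r_n > ν^n for infinitely many n, where μ < ν < ρ.
  by_contra! hlt
  have hbdd : IsBoundedUnder (· ≤ ·) atTop
      fun n : ℕ => (numReducedReturns s n : ℝ) ^ (1 / (n : ℝ)) := by
    refine isBoundedUnder_of ⟨_, fun n => le_trans ?_ (numReturns_rpow_le s n)⟩
    have : (numReducedReturns s n : ℝ) ≤ numReturns s n := by
      exact_mod_cast numReducedReturns_le s n
    gcongr
  have hev : ∀ᶠ n : ℕ in atTop, (numReducedReturns s n : ℝ) ≤ c ^ n := by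
    filter_upwards [eventually_lt_of_limsup_lt hlt hbdd, eventually_gt_atTop 0] with n hn hn0
    have := pow_le_pow_left₀ (by positivity) hn.le n
    rwa [one_div, Real.rpow_inv_natCast_pow (by positivity) hn0.ne'] at this
  obtain ⟨n₀, hn₀⟩ := eventually_atTop.1 hev
  obtain ⟨C, hC1, hC⟩ : ∃ C : ℝ, 1 ≤ C ∧ ∀ k, (numReducedReturns s k : ℝ) * c⁻¹ ^ k ≤ C := by
    refine ⟨1 + ∑ k ∈ Finset.range n₀, (numReducedReturns s k : ℝ) * c⁻¹ ^ k, ?_, fun k => ?_⟩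
    · exact le_add_of_nonneg_right (Finset.sum_nonneg fun _ _ => by positivity)
    · rcases lt_or_ge k n₀ with hk | hk
      · have := Finset.single_le_sum (f := fun k => (numReducedReturns s k : ℝ) * c⁻¹ ^ k)
          (fun _ _ => by positivity) (Finset.mem_range.2 hk)
        linarith
      · refine le_trans ?_ (le_add_of_nonneg_right (Finset.sum_nonneg fun _ _ => by positivity))
        rw [inv_pow, mul_inv_le_iff₀ (by positivity), one_mul]
        exact hn₀ k hk
  have hr : ∀ n, (numReturns s n : ℝ) ≤ C * (n + 1) * μ ^ n := by
    intro n
    refine (numReturns_le_sum_numReducedReturns s hc n).trans ?_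
    calc _ ≤ ∑ k ∈ Finset.range (n + 1), C * μ ^ n := by
          refine Finset.sum_le_sum fun k _ => ?_
          calc _ = ((numReducedReturns s k : ℝ) * c⁻¹ ^ k) * μ ^ n := by ring
            _ ≤ _ := by gcongr; exact hC k
      _ = _ := by
          rw [Finset.sum_const, Finset.card_range, nsmul_eq_mul]
          push_cast
          ring
  obtain ⟨ν, hν, hνr⟩ := exists_between h
  have hfreq : ∃ᶠ n : ℕ in atTop, ν < (numReturns s n : ℝ) ^ (1 / (n : ℝ)) :=
    frequently_lt_of_lt_limsup (numReturns_isCoboundedUnder s) hνr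
  have hq : 1 < ν / μ := by rwa [one_lt_div hμ]
  have hlim : Tendsto (fun n : ℕ => (n : ℝ) ^ 1 / (ν / μ) ^ n) atTop (𝓝 0) :=
    tendsto_pow_const_div_const_pow_of_one_lt 1 hq
  have hsmall : ∀ᶠ n : ℕ in atTop, (n : ℝ) ^ 1 / (ν / μ) ^ n < 1 / (2 * C) :=
    hlim.eventually (gt_mem_nhds (by positivity))
  obtain ⟨n, hn, hn', hn1⟩ := (hfreq.and_eventually (hsmall.and (eventually_ge_atTop 1))).exists
  have h1 : ν ^ n < numReturns s n := by
    have := pow_lt_pow_left₀ hn (hμ.trans hν).le (by omega : n ≠ 0)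
    rwa [one_div, Real.rpow_inv_natCast_pow (by positivity) (by omega)] at this
  have h2 := h1.trans_le (hr n)
  rw [pow_one, div_pow, div_lt_div_iff₀ (by have := hμ.trans hν; positivity) (by positivity),
    one_mul, lt_div_iff₀ (by positivity)] at hn'
  have hn1' : (1 : ℝ) ≤ n := by exact_mod_cast hn1
  have h3 : C * (n + 1) * μ ^ n ≤ n * (2 * C) * μ ^ n := by
    refine mul_le_mul_of_nonneg_right ?_ (by positivity)
    nlinarith
  linarith

end FreeReduction

open scoped commutatorElement

/-! ### Pointed forests and the relations of Thompson's group. -/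

section ForestGroup

variable {G : Type} [Group G]

/-- Finite rooted binary trees. -/
inductive BinTree : Type
  | leaf : BinTree
  | node : BinTree → BinTree → BinTree

namespace BinTree

/-- The height of a tree. -/
def height : BinTree → ℕ
  | leaf => 0
  | node t u => max t.height u.height + 1

/-- The element of `G` that builds the tree `t` from leaves. -/
def build (a b : G) : BinTree → G
  | leaf => 1
  | node t u => build a b t * (a⁻¹ * build a b u * a) * b⁻¹

end BinTree

/-- The group element of a list of trees to the left of the pointer, nearest tree first. -/
def leftForest (a b : G) : List BinTree → G
  | [] => 1
  | t :: L => leftForest a b L * t.build a b * a⁻¹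

/-- The group element of a list of trees starting at the pointer. -/
def rightForest (a b : G) : List BinTree → G
  | [] => 1
  | t :: R => t.build a b * (a⁻¹ * rightForest a b R * a)

/-- The elements all of whose conjugates by positive powers of `a` commute with `a * b⁻¹`. -/
def shiftCommuting (a b : G) : Subgroup G where
  carrier := {h | ∀ j : ℕ, Commute (a * b⁻¹) ((a ^ (j + 1))⁻¹ * h * a ^ (j + 1))}
  one_mem' j := by simp
  mul_mem' {x y} hx hy j := by
    have h : (a ^ (j + 1))⁻¹ * (x * y) * a ^ (j + 1) =
        (a ^ (j + 1))⁻¹ * x * a ^ (j + 1) * ((a ^ (j + 1))⁻¹ * y * a ^ (j + 1)) := by group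
    rw [h]
    exact (hx j).mul_right (hy j)
  inv_mem' {x} hx j := by
    have := (hx j).inv_right
    convert this using 1
    group

theorem conj_mem_shiftCommuting {a b h : G} (hh : h ∈ shiftCommuting a b) :
    a⁻¹ * h * a ∈ shiftCommuting a b := by
  intro j
  convert hh (j + 1) using 1
  rw [pow_succ a (j + 1), pow_succ' a]
  group

variable {a b : G}

/-- The two relators of Thompson's group imply the whole infinite family of relations. -/
theorem mem_shiftCommuting_of_commute (h1 : Commute (a * b⁻¹) (a⁻¹ * b * a))
    (h2 : Commute (a * b⁻¹) ((a ^ 2)⁻¹ * b * a ^ 2)) : b ∈ shiftCommuting a b := by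
  -- With x_j = a^(-j) b a^j the first relation reads x_2 = x_0⁻¹ x_1 x_0. Conjugation by powers of
  -- a gives x_(j+2) = x_j⁻¹ x_(j+1) x_j, so commuting with a b⁻¹ propagates from x_1, x_2 to all
  -- later x_j.
  have key : (a ^ 2)⁻¹ * b * a ^ 2 = b⁻¹ * (a⁻¹ * b * a) * b := by
    have h := h1.eq
    calc (a ^ 2)⁻¹ * b * a ^ 2 = a⁻¹ * ((a⁻¹ * b * a) * (a * b⁻¹)) * b := by
          rw [sq]; group
      _ = b⁻¹ * (a⁻¹ * b * a) * b := by rw [← h]; group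
  have step : ∀ j : ℕ, (a ^ (j + 2))⁻¹ * b * a ^ (j + 2) =
      ((a ^ j)⁻¹ * b * a ^ j)⁻¹ * ((a ^ (j + 1))⁻¹ * b * a ^ (j + 1)) *
        ((a ^ j)⁻¹ * b * a ^ j) := by
    intro j
    calc (a ^ (j + 2))⁻¹ * b * a ^ (j + 2) = (a ^ j)⁻¹ * ((a ^ 2)⁻¹ * b * a ^ 2) * a ^ j := by
          rw [add_comm j 2, pow_add]; group
      _ = _ := by rw [key, add_comm j 1, pow_add]; group
  have main : ∀ j : ℕ, Commute (a * b⁻¹) ((a ^ (j + 1))⁻¹ * b * a ^ (j + 1)) ∧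
      Commute (a * b⁻¹) ((a ^ (j + 2))⁻¹ * b * a ^ (j + 2)) := by
    intro j
    induction j with
    | zero => exact ⟨by simpa using h1, h2⟩
    | succ j ih =>
      refine ⟨ih.2, ?_⟩
      rw [step (j + 1)]
      exact (ih.1.inv_right.mul_right ih.2).mul_right ih.1
  exact fun j => (main j).1

theorem BinTree.build_mem (hb : b ∈ shiftCommuting a b) (t : BinTree) :
    t.build a b ∈ shiftCommuting a b := by
  induction t with
  | leaf => exact one_mem _
  | node t u iht ihu =>
    exact mul_mem (mul_mem iht (conj_mem_shiftCommuting ihu)) (inv_mem hb)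

theorem rightForest_mem (hb : b ∈ shiftCommuting a b) (R : List BinTree) :
    rightForest a b R ∈ shiftCommuting a b := by
  induction R with
  | nil => exact one_mem _
  | cons t R ih => exact mul_mem (t.build_mem hb) (conj_mem_shiftCommuting ih)

theorem forest_shift (L R : List BinTree) (t : BinTree) :
    leftForest a b L * rightForest a b (t :: R) =
      leftForest a b (t :: L) * rightForest a b R * a := by
  simp only [leftForest, rightForest]
  group

/-- The factor b⁻¹ of the root caret must pass the trees to its right. Their contribution X = a⁻¹
(`rightForest a b R`) a commutes with a b⁻¹, so b⁻¹ X b = a⁻¹ X a. -/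
theorem forest_split (hb : b ∈ shiftCommuting a b) (L R : List BinTree) (t u : BinTree) :
    leftForest a b L * rightForest a b (t :: u :: R) =
      leftForest a b L * rightForest a b (BinTree.node t u :: R) * b := by
  have h : Commute (a * b⁻¹) (a⁻¹ * rightForest a b R * a) := by
    simpa using rightForest_mem hb R 0
  simp only [rightForest, BinTree.build]
  have e : a * b⁻¹ * (a⁻¹ * rightForest a b R * a) * b = (a⁻¹ * rightForest a b R * a) * a := by
    rw [h.eq]; group
  calc _ = leftForest a b L * t.build a b * a⁻¹ * u.build a b *
        ((a⁻¹ * rightForest a b R * a) * a) := by group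
    _ = _ := by rw [← e]; group

end ForestGroup

/-! ### Product states on forests. -/

section ForestState

open Classical in
/-- The lists of length `n` with entries in `T`. -/
noncomputable def listsOfLength {α : Type} (T : Finset α) : ℕ → Finset (List α)
  | 0 => {[]}
  | n + 1 => (T ×ˢ listsOfLength T n).image fun p => p.1 :: p.2

theorem cons_mem_listsOfLength {α : Type} {T : Finset α} {n : ℕ} {t : α} {L : List α} (ht : t ∈ T)
    (hL : L ∈ listsOfLength T n) : t :: L ∈ listsOfLength T (n + 1) := by
  classical
  exact Finset.mem_image.2 ⟨(t, L), Finset.mk_mem_product ht hL, rfl⟩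

theorem sum_listsOfLength {α : Type} (T : Finset α) (ψ : α → ℝ) (hψ : ∑ t ∈ T, ψ t ^ 2 = 1)
    (n : ℕ) : ∑ L ∈ listsOfLength T n, (L.map ψ).prod ^ 2 = 1 := by
  classical
  induction n with
  | zero => simp [listsOfLength]
  | succ n ih =>
    rw [listsOfLength, Finset.sum_image, Finset.sum_product]
    · simp only [List.map_cons, List.prod_cons, mul_pow, ← Finset.mul_sum, ih, mul_one, hψ]
    · rintro ⟨x, L⟩ _ ⟨y, L'⟩ _ h
      simpa using h

/-- A product state on forests of binary trees bounds `ρ` from below for every group satisfying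
the relations of Thompson's group. -/
theorem le_rho_of_forestState {G : Type} [Group G] (s : Fin 2 → G)
    (hb : s 1 ∈ shiftCommuting (s 0) (s 1)) (T : Finset BinTree) (P : Finset (BinTree × BinTree))
    (hP : ∀ p ∈ P, p.1 ∈ T ∧ p.2 ∈ T ∧ BinTree.node p.1 p.2 ∈ T) (ψ : BinTree → ℝ)
    (hψ0 : ∀ t, 0 ≤ ψ t) (hψ : ∑ t ∈ T, ψ t ^ 2 = 1) {l : ℝ}
    (hl : l < 2 + 2 * ∑ p ∈ P, ψ p.1 * ψ p.2 * ψ (BinTree.node p.1 p.2)) : l ≤ rho s := by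
  classical
  set E := ∑ p ∈ P, ψ p.1 * ψ p.2 * ψ (BinTree.node p.1 p.2) with hE
  -- On a K + 1 by K + 1 window the quotient is (2 + 2E) K / (K + 1), which is at least l for this
  -- K.
  obtain ⟨K, hK⟩ := exists_nat_gt ((2 + 2 * E) / (2 + 2 * E - l))
  rw [div_lt_iff₀ (by linarith)] at hK
  let w : List BinTree → ℝ := fun L => (L.map ψ).prod
  have hw0 : ∀ L, 0 ≤ w L := fun L => List.prod_nonneg fun x hx => by
    obtain ⟨t, -, rfl⟩ := List.mem_map.1 hx
    exact hψ0 t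
  have hw : ∀ n, ∑ L ∈ listsOfLength T n, w L ^ 2 = 1 := sum_listsOfLength T ψ hψ
  -- A vertex over (i, k) has i trees left of the pointer and 2K + 3 + k trees in all: a changes i,
  -- and b raises k. Since i ≤ K on the window, the subtraction never truncates.
  let len : ℕ × ℕ → ℕ := fun x => 2 * K + 2 + x.2 - x.1
  let S : Finset (Σ _ : ℕ × ℕ, List BinTree × List BinTree) :=
    (Finset.range (K + 1) ×ˢ Finset.range (K + 1)).sigma fun x =>
      listsOfLength T x.1 ×ˢ listsOfLength T (len x + 1)
  let A : Finset (Σ _ : ℕ × ℕ, BinTree × List BinTree × List BinTree) :=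
    (Finset.range K ×ˢ Finset.range (K + 1)).sigma fun x =>
      T ×ˢ listsOfLength T x.1 ×ˢ listsOfLength T (len x)
  let B : Finset (Σ _ : ℕ × ℕ, (BinTree × BinTree) × List BinTree × List BinTree) :=
    (Finset.range (K + 1) ×ˢ Finset.range K).sigma fun x =>
      P ×ˢ listsOfLength T x.1 ×ˢ listsOfLength T (len x)
  have hS : ∑ x ∈ S, (w x.2.1 * w x.2.2) ^ 2 = (K + 1) * (K + 1) := by
    rw [Finset.sum_sigma]
    simp only [Finset.sum_product, mul_pow, ← Finset.mul_sum, hw, mul_one]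
    simp [mul_add]
  refine le_rho_of_edge_families s
    (fun x => leftForest (s 0) (s 1) x.2.1 * rightForest (s 0) (s 1) x.2.2) S
    A (fun e => ⟨(e.1.1 + 1, e.1.2), (e.2.1 :: e.2.2.1, e.2.2.2)⟩)
      (fun e => ⟨e.1, (e.2.2.1, e.2.1 :: e.2.2.2)⟩)
    B (fun e => ⟨e.1, (e.2.2.1, BinTree.node e.2.1.1 e.2.1.2 :: e.2.2.2)⟩)
      (fun e => ⟨(e.1.1, e.1.2 + 1), (e.2.2.1, e.2.1.1 :: e.2.1.2 :: e.2.2.2)⟩)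
    ?_ ?_ ?_ ?_ ?_ ?_ ?_ ?_ (fun x => w x.2.1 * w x.2.2)
    (fun x => mul_nonneg (hw0 _) (hw0 _)) ?_ ?_
  · rintro ⟨⟨i, k⟩, t, L, R⟩ he
    simp only [A, S, len, Finset.mem_sigma, Finset.mem_product, Finset.mem_range] at he ⊢
    obtain ⟨⟨hi, hk⟩, ht, hL, hR⟩ := he
    refine ⟨⟨⟨by omega, hk⟩, cons_mem_listsOfLength ht hL, ?_⟩, ⟨by omega, hk⟩, hL,
      cons_mem_listsOfLength ht hR⟩
    convert hR using 2
    omega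
  · rintro ⟨⟨i, k⟩, ⟨t, u⟩, L, R⟩ he
    simp only [B, S, len, Finset.mem_sigma, Finset.mem_product, Finset.mem_range] at he ⊢
    obtain ⟨⟨hi, hk⟩, htu, hL, hR⟩ := he
    obtain ⟨ht, hu, hn⟩ := hP _ htu
    refine ⟨⟨⟨hi, by omega⟩, hL, cons_mem_listsOfLength hn hR⟩, ⟨hi, by omega⟩, hL, ?_⟩
    convert cons_mem_listsOfLength ht (cons_mem_listsOfLength hu hR) using 2
    omega
  · rintro ⟨x, t, L, R⟩ _
    exact forest_shift L R t
  · rintro ⟨x, ⟨t, u⟩, L, R⟩ _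
    exact forest_split hb L R t u
  · rintro ⟨⟨i, k⟩, t, L, R⟩ _ ⟨⟨i', k'⟩, t', L', R'⟩ _ h
    simp only [Sigma.mk.injEq, Prod.mk.injEq, heq_eq_eq, List.cons.injEq] at h
    obtain ⟨⟨h1, rfl⟩, ⟨rfl, rfl⟩, rfl⟩ := h
    obtain rfl : i = i' := by omega
    rfl
  · rintro ⟨⟨i, k⟩, t, L, R⟩ _ ⟨⟨i', k'⟩, t', L', R'⟩ _ h
    simp only [Sigma.mk.injEq, Prod.mk.injEq, heq_eq_eq, List.cons.injEq] at h
    obtain ⟨⟨rfl, rfl⟩, rfl, rfl, rfl⟩ := h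
    rfl
  · rintro ⟨⟨i, k⟩, ⟨t, u⟩, L, R⟩ _ ⟨⟨i', k'⟩, ⟨t', u'⟩, L', R'⟩ _ h
    simp only [Sigma.mk.injEq, Prod.mk.injEq, heq_eq_eq, List.cons.injEq,
      BinTree.node.injEq] at h
    obtain ⟨⟨rfl, rfl⟩, rfl, ⟨rfl, rfl⟩, rfl⟩ := h
    rfl
  · rintro ⟨⟨i, k⟩, ⟨t, u⟩, L, R⟩ _ ⟨⟨i', k'⟩, ⟨t', u'⟩, L', R'⟩ _ h
    simp only [Sigma.mk.injEq, Prod.mk.injEq, heq_eq_eq, List.cons.injEq] at h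
    obtain ⟨⟨rfl, h1⟩, rfl, rfl, rfl, rfl⟩ := h
    obtain rfl : k = k' := by omega
    rfl
  · rw [hS]
    positivity
  -- Moving the pointer leaves the product weight unchanged, so each admissible (i, k) contributes
  -- 1; in `hB` it contributes `E`.
  · have hA : ∑ e ∈ A, w (e.2.1 :: e.2.2.1) * w e.2.2.2 * (w e.2.2.1 * w (e.2.1 :: e.2.2.2)) =
        K * (K + 1) := by
      have e1 : ∀ (t : BinTree) (L R : List BinTree),
          w (t :: L) * w R * (w L * w (t :: R)) = ψ t ^ 2 * (w L ^ 2 * w R ^ 2) := by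
        intro t L R
        simp only [w, List.map_cons, List.prod_cons]
        ring
      rw [Finset.sum_sigma]
      simp only [Finset.sum_product, e1, ← Finset.mul_sum, hw, mul_one, hψ]
      simp [mul_add]
    have hB : ∑ e ∈ B, w e.2.2.1 * w (BinTree.node e.2.1.1 e.2.1.2 :: e.2.2.2) *
        (w e.2.2.1 * w (e.2.1.1 :: e.2.1.2 :: e.2.2.2)) = (K + 1) * K * E := by
      have e1 : ∀ (p : BinTree × BinTree) (L R : List BinTree),
          w L * w (BinTree.node p.1 p.2 :: R) * (w L * w (p.1 :: p.2 :: R)) =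
            ψ p.1 * ψ p.2 * ψ (BinTree.node p.1 p.2) * (w L ^ 2 * w R ^ 2) := by
        intro p L R
        simp only [w, List.map_cons, List.prod_cons]
        ring
      have e2 : ∀ x : ℕ × ℕ, ∑ e ∈ P ×ˢ listsOfLength T x.1 ×ˢ listsOfLength T (len x),
          w e.2.1 * w (BinTree.node e.1.1 e.1.2 :: e.2.2) *
            (w e.2.1 * w (e.1.1 :: e.1.2 :: e.2.2)) = E := by
        intro x
        rw [Finset.sum_product]
        refine Finset.sum_congr rfl fun p _ => ?_
        simp only [Finset.sum_product, e1, ← Finset.mul_sum, hw, mul_one]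
      rw [Finset.sum_sigma]
      simp only [e2]
      simp
    rw [hS]
    refine le_of_le_of_eq ?_ (congrArg (2 * ·) (congrArg₂ (· + ·) hA hB)).symm
    have hK0 : (0 : ℝ) ≤ K := K.cast_nonneg
    have : l * (K + 1) ≤ (2 + 2 * E) * K := by nlinarith
    nlinarith

end ForestState

/-! ### Height-dependent tree weights and the estimate for F. -/

section ForestWeights

/-- Tree weights that depend on the heights of all subtrees through the factors `c`. -/
noncomputable def treeWeight (x : ℝ) (c : ℕ → ℝ) : BinTree → ℝ
  | .leaf => x
  | .node t u => c (max t.height u.height) * (treeWeight x c t * treeWeight x c u)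

open Classical in
/-- The trees of height at most `h`. -/
noncomputable def treesOfHeight : ℕ → Finset BinTree
  | 0 => {.leaf}
  | h + 1 => insert .leaf ((treesOfHeight h ×ˢ treesOfHeight h).image fun p => .node p.1 p.2)

theorem mem_treesOfHeight {h : ℕ} {t : BinTree} : t ∈ treesOfHeight h ↔ t.height ≤ h := by
  classical
  induction h generalizing t with
  | zero => cases t <;> simp [treesOfHeight, BinTree.height]
  | succ h ih => cases t <;> simp [treesOfHeight, BinTree.height, ih]

variable (x : ℝ) (c : ℕ → ℝ)

/-- The total squared weight of the trees of height at most `h`. -/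
noncomputable def treeMass (h : ℕ) : ℝ := ∑ t ∈ treesOfHeight h, treeWeight x c t ^ 2

/-- Weighted sums over pairs of trees of height at most `h`. -/
noncomputable def pairSum (w : ℕ → ℝ) (h : ℕ) : ℝ :=
  ∑ p ∈ treesOfHeight h ×ˢ treesOfHeight h,
    w (max p.1.height p.2.height) * (treeWeight x c p.1 ^ 2 * treeWeight x c p.2 ^ 2)

theorem treeMass_zero : treeMass x c 0 = x ^ 2 := by
  simp [treeMass, treesOfHeight, treeWeight]

theorem treeMass_succ (h : ℕ) :
    treeMass x c (h + 1) = x ^ 2 + pairSum x c (fun i => c i ^ 2) h := by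
  classical
  rw [treeMass, treesOfHeight, Finset.sum_insert (by simp), Finset.sum_image (by
    rintro ⟨t, u⟩ _ ⟨t', u'⟩ _ h; simpa using h)]
  simp only [treeWeight, mul_pow, pairSum]

theorem pairSum_zero (w : ℕ → ℝ) : pairSum x c w 0 = w 0 * (treeMass x c 0) ^ 2 := by
  rw [pairSum, treeMass, treesOfHeight, Finset.sum_product]
  simp only [Finset.sum_singleton, treeWeight, BinTree.height, max_self]
  ring

/-- The pairs added at this stage have maximal height exactly `h + 1`, so they all carry `w (h +
1)`. With `treeMass_succ` this reduces sums over huge sets of trees to a short recursion. -/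
theorem pairSum_succ (w : ℕ → ℝ) (h : ℕ) : pairSum x c w (h + 1) =
    pairSum x c w h + w (h + 1) * (treeMass x c (h + 1) ^ 2 - treeMass x c h ^ 2) := by
  classical
  have hsub : treesOfHeight h ⊆ treesOfHeight (h + 1) := fun t ht =>
    mem_treesOfHeight.2 ((mem_treesOfHeight.1 ht).trans h.le_succ)
  have hsub2 := Finset.product_subset_product hsub hsub
  have e : ∀ k, treeMass x c k ^ 2 = ∑ p ∈ treesOfHeight k ×ˢ treesOfHeight k,
      treeWeight x c p.1 ^ 2 * treeWeight x c p.2 ^ 2 := by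
    intro k
    rw [sq, treeMass, Finset.sum_mul_sum, Finset.sum_product]
  rw [e, e, pairSum, pairSum, ← Finset.sum_sdiff hsub2, ← Finset.sum_sdiff hsub2,
    add_sub_cancel_right, Finset.mul_sum, add_comm]
  congr 1
  refine Finset.sum_congr rfl fun p hp => ?_
  have : max p.1.height p.2.height = h + 1 := by
    simp only [Finset.mem_sdiff, Finset.mem_product, mem_treesOfHeight] at hp
    omega
  rw [this]

theorem sum_pairs_eq_pairSum (h : ℕ) :
    ∑ p ∈ treesOfHeight h ×ˢ treesOfHeight h, treeWeight x c p.1 * treeWeight x c p.2 *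
      treeWeight x c (.node p.1 p.2) = pairSum x c c h := by
  refine Finset.sum_congr rfl fun p _ => ?_
  rw [treeWeight]
  ring

theorem treeWeight_nonneg (hx : 0 ≤ x) (hc : ∀ i, 0 ≤ c i) (t : BinTree) :
    0 ≤ treeWeight x c t := by
  induction t with
  | leaf => exact hx
  | node t u iht ihu => exact mul_nonneg (hc _) (mul_nonneg iht ihu)

theorem thompsonGen_mem_shiftCommuting :
    thompsonGen 1 ∈ shiftCommuting (thompsonGen 0) (thompsonGen 1) := by
  have key : ∀ x y : FreeGroup (Fin 2), ⁅x, y⁆ ∈ ({⁅fa * fb⁻¹, fa⁻¹ * fb * fa⁆,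
      ⁅fa * fb⁻¹, (fa ^ 2)⁻¹ * fb * fa ^ 2⁆} : Set (FreeGroup (Fin 2))) →
      Commute (PresentedGroup.mk {⁅fa * fb⁻¹, fa⁻¹ * fb * fa⁆,
        ⁅fa * fb⁻¹, (fa ^ 2)⁻¹ * fb * fa ^ 2⁆} x) (PresentedGroup.mk _ y) := by
    intro x y h
    rw [← commutatorElement_eq_one_iff_commute, ← map_commutatorElement]
    exact PresentedGroup.one_of_mem h
  exact mem_shiftCommuting_of_commute (key _ _ (Or.inl rfl)) (key _ _ (Or.inr rfl))

/-- The factors of the tree weights used for Thompson's group. -/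
noncomputable def thompsonFactor (y : ℝ) : ℕ → ℝ
  | 0 => 5 / 2
  | 1 => 3 / 2
  | 2 => 1
  | 3 => 5 / 6
  | 4 => 2 / 3
  | _ => y

theorem le_rho_thompsonGen : 3.57 ≤ rho thompsonGen := by
  have hx : √(1 / 6 : ℝ) ^ 2 = 1 / 6 := Real.sq_sqrt (by norm_num)
  -- The mass at height h uses only factors of index below h, so `y` first appears at height 6.
  have m0 : ∀ y, treeMass √(1 / 6) (thompsonFactor y) 0 = 1 / 6 := fun y => by
    rw [treeMass_zero, hx]
  have p0 : ∀ y w, pairSum √(1 / 6) (thompsonFactor y) w 0 = w 0 * (1 / 36) := fun y w => by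
    rw [pairSum_zero, m0]; norm_num
  have m1 : ∀ y, treeMass √(1 / 6) (thompsonFactor y) 1 = 49 / 144 := fun y => by
    rw [treeMass_succ, hx, p0]; norm_num [thompsonFactor]
  have p1 : ∀ y w, pairSum √(1 / 6) (thompsonFactor y) w 1 = _ := fun y w => by
    rw [pairSum_succ, p0, m0, m1]
  have m2 : ∀ y, treeMass √(1 / 6) (thompsonFactor y) 2 = 4961 / 9216 := fun y => by
    rw [treeMass_succ, hx, p1]; norm_num [thompsonFactor]
  have p2 : ∀ y w, pairSum √(1 / 6) (thompsonFactor y) w 2 = _ := fun y w => by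
    rw [pairSum_succ, p1, m1, m2]
  have m3 : ∀ y, treeMass √(1 / 6) (thompsonFactor y) 3 = 20165867 / 28311552 := fun y => by
    rw [treeMass_succ, hx, p2]; norm_num [thompsonFactor]
  have p3 : ∀ y w, pairSum √(1 / 6) (thompsonFactor y) w 3 = _ := fun y w => by
    rw [pairSum_succ, p2, m2, m3]
  have m4 : ∀ y, treeMass √(1 / 6) (thompsonFactor y) 4 =
      24913340210661649 / 28855583159353344 := fun y => by
    rw [treeMass_succ, hx, p3]; norm_num [thompsonFactor]
  have p4 : ∀ y w, pairSum √(1 / 6) (thompsonFactor y) w 4 = _ := fun y w => by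
    rw [pairSum_succ, p3, m3, m4]
  have m5 : ∀ y, treeMass √(1 / 6) (thompsonFactor y) 5 =
      1815733591939614972803519911015201 / 1873450528799301705673332548960256 := fun y => by
    rw [treeMass_succ, hx, p4]; norm_num [thompsonFactor]
  have p5 : ∀ y w, pairSum √(1 / 6) (thompsonFactor y) w 5 = _ := fun y w => by
    rw [pairSum_succ, p4, m4, m5]
  have m6 : ∀ y, treeMass √(1 / 6) (thompsonFactor y) 6 = _ := fun y => by
    rw [treeMass_succ, hx, p5]
  -- The normalisation is linear in y², and the fraction under the root is its solution.
  obtain ⟨y, hy, hm⟩ : ∃ y : ℝ, 0.39 ≤ y ∧ treeMass √(1 / 6) (thompsonFactor y) 6 = 1 := by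
    refine ⟨√(1138208693478484396712979846124925584476124178605843911712702464 /
      7164017975293148617808908102992709040433176032784082398035073375), ?_, ?_⟩
    · exact Real.le_sqrt_of_sq_le (by norm_num)
    · rw [m6]
      simp only [thompsonFactor]
      rw [Real.sq_sqrt (by norm_num)]
      norm_num
  refine le_rho_of_forestState thompsonGen thompsonGen_mem_shiftCommuting (treesOfHeight 6)
    (treesOfHeight 5 ×ˢ treesOfHeight 5) ?_ (treeWeight √(1 / 6) (thompsonFactor y)) ?_ hm ?_
  · intro p hp
    simp only [Finset.mem_product, mem_treesOfHeight, BinTree.height] at hp ⊢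
    omega
  · refine treeWeight_nonneg _ _ (Real.sqrt_nonneg _) fun i => ?_
    unfold thompsonFactor
    split <;> positivity
  · rw [sum_pairs_eq_pairSum, p5]
    simp only [thompsonFactor]
    norm_num at hy ⊢
    linarith

end ForestWeights

/-! ### Sums of periodic functions. -/

section PeriodicSums

theorem sum_range_mul_of_periodic {F : ℕ → ℝ} {P : ℕ} (hF : ∀ m, F (m + P) = F m) (k : ℕ) :
    ∑ m ∈ Finset.range (P * k), F m = k * ∑ m ∈ Finset.range P, F m := by
  have hF' : ∀ k m, F (P * k + m) = F m := by
    intro k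
    induction k with
    | zero => simp
    | succ k ih =>
      intro m
      rw [← ih m, ← hF (P * k + m)]
      congr 1
      ring
  induction k with
  | zero => simp
  | succ k ih =>
    rw [mul_add, mul_one, Finset.sum_range_add, ih]
    simp only [hF']
    push_cast
    ring

theorem periodic_mul {F : ℕ → ℝ} {P : ℕ} (hF : ∀ m, F (m + P) = F m) (k m : ℕ) :
    F (m + P * k) = F m := by
  induction k with
  | zero => simp
  | succ k ih => rw [mul_add, mul_one, ← add_assoc, hF, ih]

end PeriodicSums

/-! ### The tree of a-lines of a Baumslag–Solitar relation. -/

section TreeOfLines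

/-- A syllable `⟨ε, r⟩` stands for `a ^ r * b` or `a ^ r * b⁻¹`. -/
abbrev Syllable : Type := Σ _ : Bool, ℕ

/-- The sign of the last syllable; syllable lists have their last syllable at the head. -/
def lastSign : List Syllable → Bool
  -- The root is treated as if entered through b. This only discards the branch b⁻¹ with exponent 0,
  -- harmless for a lower bound.
  | [] => true
  | σ :: _ => σ.1

theorem lastSign_cons (σ : Syllable) (l : List Syllable) : lastSign (σ :: l) = σ.1 := rfl

/-- The syllables that may follow a syllable of sign `τ` in a reduced sequence, where the exponent
before `b` is taken modulo `d true` and the exponent before `b⁻¹` modulo `d false`. -/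
def nextSyllables (d : Bool → ℕ) (τ : Bool) : Finset Syllable :=
  (Finset.univ : Finset Bool).sigma fun ε =>
    if ε = τ then Finset.range (d ε) else Finset.Ico 1 (d ε)

/-- The reduced sequences of `k` syllables. -/
def reducedSyllables (d : Bool → ℕ) : ℕ → Finset (List Syllable)
  | 0 => {[]}
  | k + 1 => ((reducedSyllables d k).sigma fun l => nextSyllables d (lastSign l)).image
      fun x => x.2 :: x.1

/-- The lengths of the segments of `a`-lines over the syllable sequences. -/
def lineLength (d : Bool → ℕ) (n : ℕ) : List Syllable → ℕ
  | [] => n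
  | σ :: l => lineLength d n l / d σ.1 * d (!σ.1)

/-- The amplitude of a syllable sequence for given transition amplitudes `w`. -/
noncomputable def amplitude (w : Bool → Syllable → ℝ) : List Syllable → ℝ
  | [] => 1
  | σ :: l => amplitude w l * w (lastSign l) σ

/-- The group element at position `0` of the line over a syllable sequence. -/
def lineBase {G : Type} [Group G] (a b : G) : List Syllable → G
  | [] => 1
  | σ :: l => lineBase a b l * a ^ σ.2 * if σ.1 then b else b⁻¹

variable {d : Bool → ℕ}

theorem lt_of_mem_nextSyllables {τ : Bool} {σ : Syllable} (h : σ ∈ nextSyllables d τ) :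
    σ.2 < d σ.1 := by
  rw [nextSyllables, Finset.mem_sigma] at h
  have := h.2
  split_ifs at this
  · exact Finset.mem_range.1 this
  · exact (Finset.mem_Ico.1 this).2

theorem pos_of_mem_nextSyllables {τ : Bool} {σ : Syllable} (h : σ ∈ nextSyllables d τ)
    (hσ : σ.1 ≠ τ) : 0 < σ.2 := by
  rw [nextSyllables, Finset.mem_sigma, if_neg hσ] at h
  exact (Finset.mem_Ico.1 h.2).1

theorem sum_nextSyllables (τ : Bool) (F : Syllable → ℝ) : ∑ σ ∈ nextSyllables d τ, F σ =
    ∑ r ∈ Finset.range (d τ), F ⟨τ, r⟩ + ∑ r ∈ Finset.Ico 1 (d (!τ)), F ⟨!τ, r⟩ := by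
  rw [nextSyllables, Finset.sum_sigma]
  cases τ <;> simp [add_comm]

theorem sum_reducedSyllables_succ (k : ℕ) (F : List Syllable → ℝ) :
    ∑ l ∈ reducedSyllables d (k + 1), F l =
      ∑ l ∈ reducedSyllables d k, ∑ σ ∈ nextSyllables d (lastSign l), F (σ :: l) := by
  rw [reducedSyllables, Finset.sum_image, Finset.sum_sigma]
  rintro ⟨l, σ⟩ _ ⟨l', σ'⟩ _ h
  simp only [List.cons.injEq] at h
  obtain ⟨rfl, rfl⟩ := h
  rfl

theorem cons_mem_reducedSyllables {k : ℕ} {l : List Syllable} {σ : Syllable}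
    (hl : l ∈ reducedSyllables d k) (hσ : σ ∈ nextSyllables d (lastSign l)) :
    σ :: l ∈ reducedSyllables d (k + 1) :=
  Finset.mem_image.2 ⟨⟨l, σ⟩, Finset.mem_sigma.2 ⟨hl, hσ⟩, rfl⟩

/-- The lengths of all lines up to depth `D` are divisible by the period. -/
theorem exists_lineLength_eq (hd : ∀ ε, 0 < d ε) {D k : ℕ} (n : ℕ) (hk : k ≤ D)
    {l : List Syllable} (hl : l ∈ reducedSyllables d k) : ∃ c, n ≤ c ∧
      lineLength d ((d true * d false) ^ (D + 1) * n) l =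
        (d true * d false) ^ (D + 1 - k) * c := by
  induction k generalizing l with
  | zero =>
    obtain rfl : l = [] := by simpa [reducedSyllables] using hl
    exact ⟨n, le_rfl, rfl⟩
  | succ k ih =>
    obtain ⟨⟨l', σ⟩, hx, rfl⟩ := Finset.mem_image.1 hl
    obtain ⟨hl', -⟩ := Finset.mem_sigma.1 hx
    obtain ⟨c, hc, e⟩ := ih (by omega) hl'
    refine ⟨d (!σ.1) * d (!σ.1) * c, hc.trans (Nat.le_mul_of_pos_left _ (mul_pos (hd _) (hd _))),
      ?_⟩
    have hP : d true * d false = d σ.1 * d (!σ.1) := by cases σ.1 <;> simp [mul_comm]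
    have hpow : D + 1 - k = (D + 1 - (k + 1)) + 1 := by omega
    rw [lineLength, e, hpow, pow_succ]
    have : (d true * d false) ^ (D + 1 - (k + 1)) * (d true * d false) * c =
        d σ.1 * ((d true * d false) ^ (D + 1 - (k + 1)) * d (!σ.1) * c) := by
      conv_lhs => enter [1, 2]; rw [hP]
      ring
    rw [this, Nat.mul_div_cancel_left _ (hd _)]
    ring

/-- The two endpoints, over the shorter and over the longer syllable sequence, of the edges between
neighbouring lines. -/
def lineEdgeEnd (d : Bool → ℕ) (upper : Bool)
    (e : Σ _ : (Σ _ : (Σ _ : ℕ, List Syllable), Syllable), ℕ) :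
    Σ _ : (Σ _ : ℕ, List Syllable), ℕ :=
  if upper then ⟨⟨e.1.1.1 + 1, e.1.2 :: e.1.1.2⟩, d (!e.1.2.1) * e.2⟩
  else ⟨e.1.1, e.1.2.2 + d e.1.2.1 * e.2⟩

/-- A position on the shorter line determines residue and quotient modulo `d ε`. An edge up and an
edge back down cannot share an endpoint in the same direction: the edge back sits at a multiple of
the modulus, whereas reducedness gives the other a nonzero residue. -/
theorem lineEdgeEnd_injOn (hd : ∀ ε, 0 < d ε) (β : Bool) :
    Set.InjOn (fun e => lineEdgeEnd d (e.1.2.1 == β) e)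
      {e | e.1.2 ∈ nextSyllables d (lastSign e.1.1.2)} := by
  have mixed : ∀ {k k' : ℕ} {l l' : List Syllable} {r r' j j' : ℕ} {ε : Bool},
      (⟨ε, r⟩ : Syllable) ∈ nextSyllables d (lastSign l) →
      lineEdgeEnd d false ⟨⟨⟨k, l⟩, ⟨ε, r⟩⟩, j⟩ ≠
        lineEdgeEnd d true ⟨⟨⟨k', l'⟩, ⟨!ε, r'⟩⟩, j'⟩ := by
    intro k k' l l' r r' j j' ε h heq
    simp only [lineEdgeEnd, Bool.false_eq_true, if_false, if_true, Sigma.mk.injEq, heq_eq_eq,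
      Bool.not_not] at heq
    obtain ⟨⟨rfl, rfl⟩, h1⟩ := heq
    have h2 := lt_of_mem_nextSyllables h
    have h3 := pos_of_mem_nextSyllables h (by simp [lastSign])
    simp only at h2 h3
    have h4 := congrArg (· % d ε) h1
    simp only [Nat.add_mul_mod_self_left, Nat.mul_mod_right, Nat.mod_eq_of_lt h2] at h4
    omega
  rintro ⟨⟨⟨k, l⟩, ⟨ε, r⟩⟩, j⟩ he ⟨⟨⟨k', l'⟩, ⟨ε', r'⟩⟩, j'⟩ he' h
  simp only [Set.mem_ofPred_eq] at he he'
  simp only at h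
  by_cases hε : ε = β <;> by_cases hε' : ε' = β
  · subst hε hε'
    simp only [beq_self_eq_true, lineEdgeEnd, if_true, Sigma.mk.injEq, heq_eq_eq,
      List.cons.injEq, Nat.add_right_cancel_iff, true_and] at h
    obtain ⟨⟨rfl, rfl, rfl⟩, h1⟩ := h
    rw [Nat.eq_of_mul_eq_mul_left (hd _) h1]
  · obtain rfl : ε' = !ε := by subst hε; cases ε <;> cases ε' <;> simp_all
    subst hε
    have e1 : ((!ε) == ε) = false := by cases ε <;> rfl
    rw [e1, beq_self_eq_true] at h
    refine absurd h.symm ?_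
    have := @mixed k' k l' l r' r j' j (!ε) he'
    rwa [Bool.not_not] at this
  · obtain rfl : ε = !ε' := by subst hε'; cases ε <;> cases ε' <;> simp_all
    subst hε'
    have e1 : ((!ε') == ε') = false := by cases ε' <;> rfl
    rw [e1, beq_self_eq_true] at h
    refine absurd h ?_
    have := @mixed k k' l l' r r' j j' (!ε') he
    rwa [Bool.not_not] at this
  · obtain rfl : ε' = ε := by cases ε <;> cases ε' <;> cases β <;> simp_all
    have e1 : (ε' == β) = false := by cases ε' <;> cases β <;> simp_all
    simp only [e1, lineEdgeEnd, Bool.false_eq_true, if_false, Sigma.mk.injEq, heq_eq_eq] at h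
    obtain ⟨⟨rfl, rfl⟩, h1⟩ := h
    have h2 := lt_of_mem_nextSyllables he
    have h3 := lt_of_mem_nextSyllables he'
    simp only at h2 h3
    have h4 := congrArg (· % d ε') h1
    simp only [Nat.add_mul_mod_self_left, Nat.mod_eq_of_lt h2, Nat.mod_eq_of_lt h3] at h4
    subst h4
    rw [Nat.eq_of_mul_eq_mul_left (hd ε') (Nat.add_left_cancel h1)]

/-- Powers of the relation slide past b or b⁻¹, so one syllable yields a whole ladder of b-edges
between two lines. -/
theorem lineEdge_relation {G : Type} [Group G] {a b : G}
    (hrel : a ^ d true * b = b * a ^ d false) (l : List Syllable) (ε : Bool) (r j : ℕ) :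
    lineBase a b (⟨ε, r⟩ :: l) * a ^ (d (!ε) * j) =
      lineBase a b l * a ^ (r + d ε * j) * if ε then b else b⁻¹ := by
  have h : ∀ j : ℕ, a ^ (d true * j) * b = b * a ^ (d false * j) := by
    intro j
    have : SemiconjBy b (a ^ d false) (a ^ d true) := hrel.symm
    have := (this.pow_right j).eq
    rw [pow_mul, pow_mul, this]
  cases ε
  · have h' : b⁻¹ * a ^ (d true * j) = a ^ (d false * j) * b⁻¹ := by
      rw [eq_mul_inv_iff_mul_eq, mul_assoc, h, inv_mul_cancel_left]
    simp only [lineBase, Bool.false_eq_true, if_false, Bool.not_false, pow_add, mul_assoc, h']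
  · simp only [lineBase, if_true, Bool.not_true, pow_add, mul_assoc, h]

end TreeOfLines

/-! ### Periodic states on the tree of lines. -/

section LineState

variable {d : Bool → ℕ}

/-- A state on the tree of `a`-lines, given by periodic profiles `u` along the lines and transition
amplitudes `w` between them, bounds `ρ` from below for every group in which `b` conjugates
`a ^ d false` to `a ^ d true`. -/
theorem le_rho_of_lineState {G : Type} [Group G] (s : Fin 2 → G) (hd : ∀ ε, 0 < d ε)
    (hrel : s 0 ^ d true * s 1 = s 1 * s 0 ^ d false) (u : Bool → ℕ → ℝ)
    (hu : ∀ τ m, 0 ≤ u τ m) (hu0 : ∀ τ, 0 < u τ 0) (hper : ∀ τ m, u τ (m + d (!τ)) = u τ m)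
    (w : Bool → Syllable → ℝ) (hw : ∀ τ σ, 0 ≤ w τ σ)
    (hw1 : ∀ τ, ∑ σ ∈ nextSyllables d τ, w τ σ ^ 2 * (d (!σ.1) / d σ.1) ≤ 1) {l l' : ℝ}
    (hl : l < l')
    (h : ∀ τ, l' * ∑ m ∈ Finset.range (d true * d false), u τ m ^ 2 ≤
      2 * ∑ m ∈ Finset.range (d true * d false), u τ m * u τ (m + 1) +
        2 * ∑ σ ∈ nextSyllables d τ,
          w τ σ * ((∑ j ∈ Finset.range (d (!σ.1)), u τ (σ.2 + d σ.1 * j)) * u σ.1 0)) :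
    l ≤ rho s := by
  classical
  set P := d true * d false with hPdef
  have hP0 : 0 < P := mul_pos (hd _) (hd _)
  have hPε : ∀ ε, P = d ε * d (!ε) := by intro ε; cases ε <;> simp [hPdef, mul_comm]
  have hperP : ∀ τ m, u τ (m + P) = u τ m := by
    intro τ m
    rw [hPε (!τ), Bool.not_not]
    exact periodic_mul (hper τ) _ _
  set n : Bool → ℝ := fun τ => ∑ m ∈ Finset.range P, u τ m ^ 2 with hn
  set A : Bool → ℝ := fun τ => ∑ m ∈ Finset.range P, u τ m * u τ (m + 1) with hA
  set K : Bool → Syllable → ℝ := fun τ σ =>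
    (∑ j ∈ Finset.range (d (!σ.1)), u τ (σ.2 + d σ.1 * j)) * u σ.1 0 with hK
  set C : Bool → ℝ := fun τ => ∑ σ ∈ nextSyllables d τ, w τ σ * K τ σ with hC
  have h' : ∀ τ, l' * n τ ≤ 2 * A τ + 2 * C τ := h
  have hn0 : ∀ τ, 0 < n τ := fun τ =>
    lt_of_lt_of_le (pow_pos (hu0 τ) 2) (Finset.single_le_sum (f := fun m => u τ m ^ 2)
      (fun m _ => sq_nonneg _) (Finset.mem_range.2 hP0))
  have hK0 : ∀ τ σ, 0 ≤ K τ σ := fun τ σ =>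
    mul_nonneg (Finset.sum_nonneg fun _ _ => hu _ _) (hu _ _)
  have hC0 : ∀ τ, 0 ≤ C τ := fun τ =>
    Finset.sum_nonneg fun σ _ => mul_nonneg (hw _ _) (hK0 _ _)
  -- This bounds the a-edge lost at the end of a finite segment.
  have hedge : ∀ τ q, 0 < q → u τ (P * q - 1) * u τ (P * q - 1 + 1) ≤ A τ := by
    intro τ q hq
    have h1 : P * q - 1 = (P - 1) + P * (q - 1) := by
      obtain ⟨q, rfl⟩ := Nat.exists_eq_succ_of_ne_zero hq.ne'
      rw [Nat.succ_sub_one, Nat.mul_succ]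
      omega
    have h2 : u τ (P * q - 1) * u τ (P * q - 1 + 1) = u τ (P - 1) * u τ (P - 1 + 1) := by
      rw [h1, periodic_mul (hperP τ), add_right_comm, periodic_mul (hperP τ)]
    rw [h2]
    exact Finset.single_le_sum (f := fun m => u τ m * u τ (m + 1))
      (fun m _ => mul_nonneg (hu _ _) (hu _ _)) (Finset.mem_range.2 (by omega))
  obtain ⟨n₀, hn₀, hn₀'⟩ : ∃ n₀, 0 < n₀ ∧ ∀ τ, n₀ ≤ n τ :=
    ⟨min (n true) (n false), lt_min (hn0 _) (hn0 _), fun τ => by cases τ <;> simp⟩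
  obtain ⟨Q, hQ0, hQ⟩ : ∃ Q, 0 ≤ Q ∧ ∀ τ, A τ ≤ Q ∧ C τ ≤ Q := by
    have hA0 : ∀ τ, 0 ≤ A τ := fun τ => Finset.sum_nonneg fun m _ => mul_nonneg (hu _ _) (hu _ _)
    refine ⟨A true + A false + C true + C false, ?_, ?_⟩
    · linarith [hA0 true, hA0 false, hC0 true, hC0 false]
    · intro τ
      cases τ <;> constructor <;> linarith [hA0 true, hA0 false, hC0 true, hC0 false]
  -- Two losses, each at most a fraction 1/(D+1) of the total mass times `Q`, must fit into the gap
  -- `l' - l`: cut segment ends, and b-edges missing above the deepest level.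
  obtain ⟨D, hD⟩ := exists_nat_gt (4 * Q / ((l' - l) * n₀))
  rw [div_lt_iff₀ (mul_pos (by linarith) hn₀)] at hD
  -- The power of `P` keeps the divisions exact through depth D with a factor `P` to spare; the
  -- factor `D + 1` gives every line at least that many periods.
  set L : List Syllable → ℕ := lineLength d (P ^ (D + 1) * (D + 1)) with hLdef
  set c : List Syllable → ℝ := amplitude w with hcdef
  have hc0 : ∀ x, 0 ≤ c x := by
    intro x
    induction x with
    | nil => exact zero_le_one
    | cons σ x ih => exact mul_nonneg ih (hw _ _)
  set mass : List Syllable → ℝ := fun x => c x ^ 2 * (L x / P) with hmass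
  have hmass0 : ∀ x, 0 ≤ mass x := fun x => by positivity
  have hLq : ∀ k ≤ D, ∀ x ∈ reducedSyllables d k, ∃ q : ℕ, D + 1 ≤ q ∧ L x = P * q := by
    intro k hk x hx
    obtain ⟨m, hm, e⟩ := exists_lineLength_eq hd (D + 1) hk hx
    refine ⟨P ^ (D - k) * m, hm.trans (Nat.le_mul_of_pos_left _ (pow_pos hP0 _)), ?_⟩
    rw [hLdef, e, ← hPdef, show D + 1 - k = D - k + 1 by omega, pow_succ]
    ring
  have hP0' : (0 : ℝ) < P := by exact_mod_cast hP0
  have hmassq : ∀ x (q : ℕ), L x = P * q → mass x = c x ^ 2 * q := by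
    intro x q hq
    simp only [hmass, hq]
    push_cast
    field_simp
  set M : ℕ → ℝ := fun k => ∑ x ∈ reducedSyllables d k, mass x with hM
  -- Appending σ multiplies the line length by `d (!σ.1) / d σ.1`, the factor in `hw1`. Masses
  -- therefore decrease with depth, and the last level holds at most 1/(D+1) of the total.
  have hMstep : ∀ k < D, M (k + 1) ≤ M k := by
    intro k hk
    simp only [hM]
    rw [sum_reducedSyllables_succ]
    refine Finset.sum_le_sum fun x hx => ?_
    obtain ⟨q, -, hq⟩ := hLq k hk.le x hx
    calc ∑ σ ∈ nextSyllables d (lastSign x), mass (σ :: x)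
        = mass x * ∑ σ ∈ nextSyllables d (lastSign x),
            w (lastSign x) σ ^ 2 * (d (!σ.1) / d σ.1) := by
          rw [Finset.mul_sum]
          refine Finset.sum_congr rfl fun σ _ => ?_
          have hdσ : (0 : ℝ) < d σ.1 := by exact_mod_cast hd σ.1
          have e1 : (L (σ :: x) : ℝ) = L x / d σ.1 * d (!σ.1) := by
            rw [hLdef, lineLength, ← hLdef, Nat.cast_mul, Nat.cast_div _ hdσ.ne']
            rw [hq, hPε σ.1, mul_assoc]
            exact dvd_mul_right _ _
          have e2 : c (σ :: x) = c x * w (lastSign x) σ := rfl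
          simp only [hmass]
          rw [e1, e2]
          ring
      _ ≤ mass x * 1 := mul_le_mul_of_nonneg_left (hw1 _) (hmass0 x)
      _ = mass x := mul_one _
  have hMD : ∀ k ≤ D, M D ≤ M k := by
    intro k hk
    induction hk using Nat.decreasingInduction with
    | self => exact le_rfl
    | of_succ k hk ih => exact ih.trans (hMstep k hk)
  have hM0 : 0 < M 0 := by
    have h1 : M 0 = (L [] : ℝ) / P := by
      simp [hM, reducedSyllables, hmass, hcdef, amplitude]
    have h2 : 0 < L [] := by
      simp only [hLdef, lineLength]
      positivity
    rw [h1]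
    positivity
  have hMnn : ∀ k, 0 ≤ M k := fun k => Finset.sum_nonneg fun x _ => hmass0 x
  set Tot := ∑ k ∈ Finset.range (D + 1), M k with hTot
  have hTot0 : 0 < Tot := lt_of_lt_of_le hM0
    (Finset.single_le_sum (f := M) (fun k _ => hMnn k) (Finset.mem_range.2 (by omega)))
  have hMDTot : (D + 1) * M D ≤ Tot := by
    calc (D + 1) * M D = ∑ k ∈ Finset.range (D + 1), M D := by simp
      _ ≤ Tot := Finset.sum_le_sum fun k hk => hMD k (by simpa [Nat.lt_succ_iff] using hk)
  let lev : Finset (Σ _ : ℕ, List Syllable) := (Finset.range (D + 1)).sigma (reducedSyllables d)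
  let S : Finset (Σ _ : (Σ _ : ℕ, List Syllable), ℕ) := lev.sigma fun x => Finset.range (L x.2)
  let EA : Finset (Σ _ : (Σ _ : ℕ, List Syllable), ℕ) :=
    lev.sigma fun x => Finset.range (L x.2 - 1)
  let EB : Finset (Σ _ : (Σ _ : (Σ _ : ℕ, List Syllable), Syllable), ℕ) :=
    (((Finset.range D).sigma (reducedSyllables d)).sigma
      fun x => nextSyllables d (lastSign x.2)).sigma fun y => Finset.range (L y.1.2 / d y.2.1)
  let f : (Σ _ : (Σ _ : ℕ, List Syllable), ℕ) → ℝ :=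
    fun v => c v.1.2 * u (lastSign v.1.2) v.2
  have hnorm : ∑ v ∈ S, f v ^ 2 = ∑ k ∈ Finset.range (D + 1), ∑ x ∈ reducedSyllables d k,
      mass x * n (lastSign x) := by
    simp only [S, lev]
    rw [Finset.sum_sigma, Finset.sum_sigma]
    refine Finset.sum_congr rfl fun k hk => Finset.sum_congr rfl fun x hx => ?_
    obtain ⟨q, -, hq⟩ := hLq k (by simpa [Nat.lt_succ_iff] using hk) x hx
    simp only [f, mul_pow, ← Finset.mul_sum]
    rw [hq, sum_range_mul_of_periodic (fun m => by rw [hperP]), hmassq x q hq]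
    ring
  have hEA : ∑ k ∈ Finset.range (D + 1), ∑ x ∈ reducedSyllables d k,
      (mass x * A (lastSign x) - mass x * (Q / (D + 1))) ≤
      ∑ v ∈ EA, f v * f ⟨v.1, v.2 + 1⟩ := by
    simp only [EA, lev]
    rw [Finset.sum_sigma, Finset.sum_sigma]
    refine Finset.sum_le_sum fun k hk => Finset.sum_le_sum fun x hx => ?_
    obtain ⟨q, hDq, hq⟩ := hLq k (by simpa [Nat.lt_succ_iff] using hk) x hx
    have hpos : 0 < P * q := mul_pos hP0 (by omega)
    have e1 := sum_range_mul_of_periodic (F := fun m => u (lastSign x) m * u (lastSign x) (m + 1))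
      (P := P) (fun m => by rw [add_right_comm, hperP, hperP]) q
    have e2 : P * q = P * q - 1 + 1 := by omega
    rw [e2, Finset.sum_range_succ] at e1
    have e3 : ∑ m ∈ Finset.range (L x - 1), f ⟨⟨k, x⟩, m⟩ * f ⟨⟨k, x⟩, m + 1⟩ =
        c x ^ 2 * ∑ m ∈ Finset.range (P * q - 1), u (lastSign x) m * u (lastSign x) (m + 1) := by
      rw [Finset.mul_sum, hq]
      exact Finset.sum_congr rfl fun m _ => by simp only [f]; ring
    rw [e3, eq_sub_of_add_eq e1, mul_sub, hmassq x q hq]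
    have e4 := (hedge (lastSign x) q (by omega)).trans (hQ (lastSign x)).1
    have e5 : Q ≤ q * (Q / (D + 1)) := by
      rw [← mul_div_assoc, le_div_iff₀ (by positivity), mul_comm]
      have : (D : ℝ) + 1 ≤ q := by exact_mod_cast hDq
      gcongr
    have e6 := mul_le_mul_of_nonneg_left (e4.trans e5) (sq_nonneg (c x))
    simp only [hA]
    linarith
  have hEB : ∑ e ∈ EB, f (lineEdgeEnd d (e.1.2.1 == false) e) *
      f (lineEdgeEnd d (e.1.2.1 == true) e) =
      ∑ k ∈ Finset.range D, ∑ x ∈ reducedSyllables d k, mass x * C (lastSign x) := by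
    simp only [EB]
    rw [Finset.sum_sigma, Finset.sum_sigma, Finset.sum_sigma]
    refine Finset.sum_congr rfl fun k hk => Finset.sum_congr rfl fun x hx => ?_
    obtain ⟨q, -, hq⟩ := hLq k (by simpa using (Finset.mem_range.1 hk).le) x hx
    simp only [hC]
    rw [Finset.mul_sum]
    refine Finset.sum_congr rfl fun σ _ => ?_
    have e1 : ∀ j, f (lineEdgeEnd d (σ.1 == false) ⟨⟨⟨k, x⟩, σ⟩, j⟩) *
        f (lineEdgeEnd d (σ.1 == true) ⟨⟨⟨k, x⟩, σ⟩, j⟩) =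
        c x ^ 2 * w (lastSign x) σ * u σ.1 0 * u (lastSign x) (σ.2 + d σ.1 * j) := by
      intro j
      have e2 : f (lineEdgeEnd d (σ.1 == false) ⟨⟨⟨k, x⟩, σ⟩, j⟩) *
          f (lineEdgeEnd d (σ.1 == true) ⟨⟨⟨k, x⟩, σ⟩, j⟩) =
          f (lineEdgeEnd d false ⟨⟨⟨k, x⟩, σ⟩, j⟩) * f (lineEdgeEnd d true ⟨⟨⟨k, x⟩, σ⟩, j⟩) := by
        obtain ⟨ε, r⟩ := σ
        cases ε
        · exact mul_comm _ _
        · rfl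
      -- Upper endpoints sit at multiples of the profile's period, so all see the same value.
      have e3 : u σ.1 (d (!σ.1) * j) = u σ.1 0 := by
        simpa using periodic_mul (hper σ.1) j 0
      rw [e2]
      simp only [lineEdgeEnd, Bool.false_eq_true, if_false, if_true, f, lastSign_cons, e3]
      rw [show c (σ :: x) = c x * w (lastSign x) σ from rfl]
      ring
    have e4 : L x / d σ.1 = d (!σ.1) * q := by
      rw [hq, hPε σ.1, mul_assoc, Nat.mul_div_cancel_left _ (hd _)]
    simp only [e1, ← Finset.mul_sum]
    rw [e4, sum_range_mul_of_periodic, hmassq x q hq]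
    · simp only [hK]
      ring
    · intro j
      rw [mul_add, ← add_assoc, ← hPε, hperP]
  refine le_rho_of_edge_families s (fun v => lineBase (s 0) (s 1) v.1.2 * s 0 ^ v.2) S
    EA (fun e => e) (fun e => ⟨e.1, e.2 + 1⟩)
    EB (fun e => lineEdgeEnd d (e.1.2.1 == false) e) (fun e => lineEdgeEnd d (e.1.2.1 == true) e)
    ?_ ?_ ?_ ?_ ?_ ?_ ?_ ?_ f (fun v => mul_nonneg (hc0 _) (hu _ _)) ?_ ?_
  · rintro ⟨x, m⟩ he
    simp only [EA, S, Finset.mem_sigma, Finset.mem_range] at he ⊢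
    exact ⟨⟨he.1, by omega⟩, he.1, by omega⟩
  · have hends : ∀ e ∈ EB, ∀ β, lineEdgeEnd d β e ∈ S := by
      rintro ⟨⟨⟨k, x⟩, σ⟩, j⟩ he β
      simp only [EB, Finset.mem_sigma, Finset.mem_range] at he
      obtain ⟨⟨⟨hk, hx⟩, hσ⟩, hj⟩ := he
      obtain ⟨q, -, hq⟩ := hLq k hk.le x hx
      have e4 : L x / d σ.1 = d (!σ.1) * q := by
        rw [hq, hPε σ.1, mul_assoc, Nat.mul_div_cancel_left _ (hd _)]
      cases β
      · simp only [lineEdgeEnd, Bool.false_eq_true, if_false, S, lev, Finset.mem_sigma,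
          Finset.mem_range]
        refine ⟨⟨by omega, hx⟩, ?_⟩
        have h1 := lt_of_mem_nextSyllables hσ
        rw [e4] at hj
        calc σ.2 + d σ.1 * j < d σ.1 + d σ.1 * j := by omega
          _ = d σ.1 * (j + 1) := by ring
          _ ≤ d σ.1 * (d (!σ.1) * q) := Nat.mul_le_mul_left _ hj
          _ = L x := by rw [hq, hPε σ.1, mul_assoc]
      · simp only [lineEdgeEnd, if_true, S, lev, Finset.mem_sigma, Finset.mem_range]
        refine ⟨⟨by omega, cons_mem_reducedSyllables hx hσ⟩, ?_⟩
        simp only [hLdef, lineLength]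
        rw [mul_comm]
        exact Nat.mul_lt_mul_of_pos_right hj (hd _)
    exact fun e he => ⟨hends e he _, hends e he _⟩
  · rintro ⟨x, m⟩ _
    simp only [pow_succ, mul_assoc]
  · rintro ⟨⟨⟨k, x⟩, ⟨ε, r⟩⟩, j⟩ _
    have := lineEdge_relation hrel x ε r j
    cases ε
    · simp only [lineEdgeEnd, beq_self_eq_true, if_true, Bool.not_false,
        show (false == true) = false from rfl, Bool.false_eq_true, if_false] at this ⊢
      rw [this, inv_mul_cancel_right]
    · simpa [lineEdgeEnd] using this
  · exact fun _ _ _ _ e => e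
  · rintro ⟨x, m⟩ _ ⟨x', m'⟩ _ e
    simp only [Sigma.mk.injEq, heq_eq_eq, Nat.add_right_cancel_iff] at e
    rw [e.1, e.2]
  · refine (lineEdgeEnd_injOn hd false).mono fun e he => ?_
    exact (Finset.mem_sigma.1 (Finset.mem_sigma.1 (Finset.mem_coe.1 he)).1).2
  · refine (lineEdgeEnd_injOn hd true).mono fun e he => ?_
    exact (Finset.mem_sigma.1 (Finset.mem_sigma.1 (Finset.mem_coe.1 he)).1).2
  · rw [hnorm]
    have : n₀ * Tot ≤ ∑ k ∈ Finset.range (D + 1), ∑ x ∈ reducedSyllables d k,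
        mass x * n (lastSign x) := by
      simp only [hTot, hM, Finset.mul_sum]
      refine Finset.sum_le_sum fun k _ => Finset.sum_le_sum fun x _ => ?_
      rw [mul_comm]
      exact mul_le_mul_of_nonneg_left (hn₀' _) (hmass0 x)
    exact lt_of_lt_of_le (mul_pos hn₀ hTot0) this
  · rw [hnorm]
    refine le_trans ?_ (mul_le_mul_of_nonneg_left (add_le_add hEA hEB.ge) zero_le_two)
    have b1 : ∑ k ∈ Finset.range D, ∑ x ∈ reducedSyllables d k, mass x * C (lastSign x) =
        ∑ k ∈ Finset.range (D + 1), ∑ x ∈ reducedSyllables d k, mass x * C (lastSign x) -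
          ∑ x ∈ reducedSyllables d D, mass x * C (lastSign x) := by
      rw [Finset.sum_range_succ]
      ring
    have b2 : ∑ x ∈ reducedSyllables d D, mass x * C (lastSign x) ≤ M D * Q := by
      simp only [hM, Finset.sum_mul]
      exact Finset.sum_le_sum fun x _ => mul_le_mul_of_nonneg_left (hQ _).2 (hmass0 x)
    have b3 : M D * Q ≤ Tot * (Q / (D + 1)) := by
      rw [← mul_div_assoc, le_div_iff₀ (by positivity)]
      calc M D * Q * (D + 1) = (D + 1) * M D * Q := by ring
        _ ≤ Tot * Q := by gcongr
    have b4 : ∑ k ∈ Finset.range (D + 1), ∑ x ∈ reducedSyllables d k,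
          l * (mass x * n (lastSign x)) ≤
        ∑ k ∈ Finset.range (D + 1), ∑ x ∈ reducedSyllables d k,
          (2 * (mass x * A (lastSign x) - mass x * (Q / (D + 1)) + mass x * C (lastSign x)) -
            2 * (Q / (D + 1)) * mass x) := by
      refine Finset.sum_le_sum fun k _ => Finset.sum_le_sum fun x _ => ?_
      have b5 : 4 * (Q / (D + 1)) ≤ (l' - l) * n (lastSign x) := by
        have : 4 * (Q / (D + 1)) ≤ (l' - l) * n₀ := by
          rw [← mul_div_assoc, div_le_iff₀ (by positivity)]
          have : 0 < (l' - l) * n₀ := mul_pos (by linarith) hn₀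
          linarith
        exact this.trans (mul_le_mul_of_nonneg_left (hn₀' _) (by linarith))
      have b6 : l * n (lastSign x) ≤ 2 * (A (lastSign x) - Q / (D + 1) + C (lastSign x)) -
          2 * (Q / (D + 1)) := by
        linarith [h' (lastSign x)]
      have := mul_le_mul_of_nonneg_left b6 (hmass0 x)
      linarith
    have b7 : ∑ k ∈ Finset.range (D + 1), ∑ x ∈ reducedSyllables d k,
          (2 * (mass x * A (lastSign x) - mass x * (Q / (D + 1)) + mass x * C (lastSign x)) -
            2 * (Q / (D + 1)) * mass x) =
        2 * (∑ k ∈ Finset.range (D + 1), ∑ x ∈ reducedSyllables d k,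
            (mass x * A (lastSign x) - mass x * (Q / (D + 1))) +
          ∑ k ∈ Finset.range (D + 1), ∑ x ∈ reducedSyllables d k, mass x * C (lastSign x)) -
        2 * (Tot * (Q / (D + 1))) := by
      simp only [hTot, hM, Finset.sum_sub_distrib, ← Finset.mul_sum, Finset.sum_add_distrib]
      ring
    simp only [← Finset.mul_sum] at b4 b7
    rw [b7] at b4
    rw [b1]
    linarith

end LineState

/-! ### Trial states for the three Baumslag–Solitar groups. -/

section BaumslagSolitar

/-- The moduli of the exponents before `b` and `b⁻¹` in `BS(p,q)`. -/
def bsModulus (p q : ℕ) (ε : Bool) : ℕ := if ε then q else p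

/-- A line profile with value `x τ` at the positions that lead back and `y τ` elsewhere. -/
noncomputable def twoValued (d : Bool → ℕ) (x y : Bool → ℝ) (τ : Bool) (m : ℕ) : ℝ :=
  if d (!τ) ∣ m then x τ else y τ

theorem bsGen_relation (p q : ℕ) :
    bsGen p q 0 ^ q * bsGen p q 1 = bsGen p q 1 * bsGen p q 0 ^ p := by
  have h : PresentedGroup.mk ({fb * fa ^ p * fb⁻¹ * (fa ^ q)⁻¹} : Set (FreeGroup (Fin 2)))
      (fb * fa ^ p * fb⁻¹ * (fa ^ q)⁻¹) = 1 := PresentedGroup.one_of_mem rfl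
  simp only [map_mul, map_pow, map_inv] at h
  rw [mul_inv_eq_one, mul_inv_eq_iff_eq_mul] at h
  exact h.symm

theorem le_rho_bsGen {p q : ℕ} (hp : 0 < p) (hq : 0 < q) (x y : Bool → ℝ) (hx : ∀ τ, 0 < x τ)
    (hy : ∀ τ, 0 ≤ y τ) (w : Bool → Syllable → ℝ) (hw : ∀ τ σ, 0 ≤ w τ σ)
    (hw1 : ∀ τ, ∑ σ ∈ nextSyllables (bsModulus p q) τ,
      w τ σ ^ 2 * (bsModulus p q (!σ.1) / bsModulus p q σ.1) ≤ 1) {l l' : ℝ} (hl : l < l')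
    (h : ∀ τ, l' * ∑ m ∈ Finset.range (q * p), twoValued (bsModulus p q) x y τ m ^ 2 ≤
      2 * ∑ m ∈ Finset.range (q * p), twoValued (bsModulus p q) x y τ m *
          twoValued (bsModulus p q) x y τ (m + 1) +
        2 * ∑ σ ∈ nextSyllables (bsModulus p q) τ, w τ σ *
          ((∑ j ∈ Finset.range (bsModulus p q (!σ.1)),
            twoValued (bsModulus p q) x y τ (σ.2 + bsModulus p q σ.1 * j)) * x σ.1)) :
    l ≤ rho (bsGen p q) := by
  refine le_rho_of_lineState (d := bsModulus p q) (bsGen p q) ?_ (bsGen_relation p q)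
    (twoValued (bsModulus p q) x y) ?_ ?_ ?_ w hw hw1 hl ?_
  · intro ε
    cases ε <;> simpa [bsModulus]
  · intro τ m
    unfold twoValued
    split_ifs
    exacts [(hx τ).le, hy τ]
  · intro τ
    simpa [twoValued] using hx τ
  · intro τ m
    simp [twoValued]
  · intro τ
    have e : ∀ ε, twoValued (bsModulus p q) x y ε 0 = x ε := fun ε => by simp [twoValued]
    simp only [e]
    exact h τ

theorem le_rho_bs22 : 3.786 ≤ rho (bsGen 2 2) := by
  refine le_rho_bsGen (p := 2) (q := 2) (by norm_num) (by norm_num) (fun _ => 1) (fun _ => 4 / 5)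
    (fun _ => by norm_num) (fun _ => by norm_num)
    -- The larger amplitude goes to the syllable leaving from positions with profile 1; the others
    -- leave from positions with profile 4/5. The squares sum to 0.9974.
    (fun τ σ => if σ.1 = τ ∧ σ.2 = 0 then 33 / 50 else 53 / 100)
    (fun τ σ => by split_ifs <;> norm_num) ?_ (l' := 3.787) (by norm_num) ?_
  · intro τ
    rw [sum_nextSyllables]
    cases τ <;> norm_num [bsModulus, Finset.sum_range_succ, Finset.sum_Ico_eq_sum_range]
  · intro τ
    rw [sum_nextSyllables]
    cases τ <;> norm_num [bsModulus, twoValued, Finset.sum_range_succ, Finset.sum_Ico_eq_sum_range]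

theorem le_rho_bs23 : 3.67 ≤ rho (bsGen 2 3) := by
  refine le_rho_bsGen (p := 2) (q := 3) (by norm_num) (by norm_num)
    (fun τ => if τ then 1 else 11 / 10) (fun _ => 4 / 5)
    (fun τ => by split_ifs <;> norm_num) (fun _ => by norm_num)
    (fun τ σ => if τ then (if σ.1 then 3 / 5 else 2 / 5) else (if σ.1 then 11 / 20 else 11 / 25))
    (fun τ σ => by split_ifs <;> norm_num) ?_ (l' := 3.68) (by norm_num) ?_
  · intro τ
    rw [sum_nextSyllables]
    cases τ <;> norm_num [bsModulus, Finset.sum_range_succ, Finset.sum_Ico_eq_sum_range]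
  · intro τ
    rw [sum_nextSyllables]
    cases τ <;> norm_num [bsModulus, twoValued, Finset.sum_range_succ, Finset.sum_Ico_eq_sum_range]

theorem le_rho_bs35 : 3.52 ≤ rho (bsGen 3 5) := by
  refine le_rho_bsGen (p := 3) (q := 5) (by norm_num) (by norm_num)
    (fun τ => if τ then 1 else 11 / 10) (fun τ => if τ then 7 / 10 else 2 / 3)
    (fun τ => by split_ifs <;> norm_num)
    (fun τ => by split_ifs <;> norm_num)
    (fun τ σ => if τ then (if σ.1 then 49 / 100 else 7 / 25)
      else (if σ.1 then 43 / 100 else 33 / 100))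
    (fun τ σ => by split_ifs <;> norm_num) ?_ (l' := 3.53) (by norm_num) ?_
  · intro τ
    rw [sum_nextSyllables]
    cases τ <;> norm_num [bsModulus, Finset.sum_range_succ, Finset.sum_Ico_eq_sum_range]
  · intro τ
    rw [sum_nextSyllables]
    cases τ <;> norm_num [bsModulus, twoValued, Finset.sum_range_succ, Finset.sum_Ico_eq_sum_range]

end BaumslagSolitar

end Cogrowth

/-! ### The numerical conclusion. -/

theorem mainTheorem1 :
    (2.5904 ≤ Cogrowth.alpha (Cogrowth.bsGen 2 2) ∧
      2.42579 ≤ Cogrowth.alpha (Cogrowth.bsGen 2 3) ∧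
      2.06357 ≤ Cogrowth.alpha (Cogrowth.bsGen 3 5) ∧
      2.17329 ≤ Cogrowth.alpha Cogrowth.thompsonGen) ∧
    (3.78522 ≤ Cogrowth.rho (Cogrowth.bsGen 2 2) ∧
      3.66250 ≤ Cogrowth.rho (Cogrowth.bsGen 2 3) ∧
      3.51736 ≤ Cogrowth.rho (Cogrowth.bsGen 3 5) ∧
      3.55368 ≤ Cogrowth.rho Cogrowth.thompsonGen) := by
  have h22 := Cogrowth.le_rho_bs22
  have h23 := Cogrowth.le_rho_bs23
  have h35 := Cogrowth.le_rho_bs35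
  have hF := Cogrowth.le_rho_thompsonGen
  refine ⟨⟨?_, ?_, ?_, ?_⟩, ?_, ?_, ?_, ?_⟩
  -- For each claimed bound c on α, the number c + 3/c lies strictly below the bound obtained for ρ.
  · exact Cogrowth.le_alpha_of_lt_rho _ (by norm_num) (lt_of_lt_of_le (by norm_num) h22)
  · exact Cogrowth.le_alpha_of_lt_rho _ (by norm_num) (lt_of_lt_of_le (by norm_num) h23)
  · exact Cogrowth.le_alpha_of_lt_rho _ (by norm_num) (lt_of_lt_of_le (by norm_num) h35)
  · exact Cogrowth.le_alpha_of_lt_rho _ (by norm_num) (lt_of_lt_of_le (by norm_num) hF)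
  · linarith
  · linarith
  · linarith
  · linarith
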